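/- **Setting.** Let $H$ be a complex Hilbert space with inner product $\langle\cdot,\cdot\rangle$, $D\subseteq H$ a dense subspace and $\Omega$ a sesquilinear form on $D$ (linear in the first, conjugate linear in the second variable). Its numerical range is $\mathfrak n_\Omega=\{\Omega(\xi,\xi):\xi\in D,\ \|\xi\|=1\}$; $\iota(\xi,\eta)=\langle\xi,\eta\rangle$ and $\vartheta$ is the null form on $H$. $\Omega$ is *q-closed* w.r.t. a norm $\|\cdot\|_\Omega$ on $D$ if $\mathcal E=D[\|\cdot\|_\Omega]$ is a reflexive Banach space, continuously embedded in $H$, and $\Omega$ is bounded on $\mathcal E$. Then $\mathfrak P(\Omega)$ is the set of bounded sesquilinear forms $\Upsilon$ on $H$ such that (i) $\xi=0$ whenever $\xi\in D$ and $(\Omega+\Upsilon)(\xi,\eta)=0$ for all $\eta\in D$, and (ii) every bounded conjugate linear functional on $\mathcal E$ is of the form $\eta\mapsto(\Omega+\Upsilon)(\xi,\eta)$ for some $\xi\in D$. $\Omega$ is *solvable* w.r.t. $\|\cdot\|_\Omega$ if it is q-closed w.r.t. this norm and $\mathfrak P(\Omega)\ne\varnothing$; it is *solvable w.r.t. an inner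 product* if moreover $\|\cdot\|_\Omega$ is induced by an inner product. "Solvable" without further qualification means solvable w.r.t. some norm. A form "satisfies" a representation theorem if it fulfils the hypotheses of that theorem, which are spelled out in each item. A "Hilbert space structure on $D$" is an inner product on $D$ making $D$ a Hilbert space continuously embedded in $H$. **Statement.** 1. (Fleige–Hassi–de Snoo.) $\Omega$ is symmetric and for some $\lambda\in\mathbb R$ the space $(D,\Omega-\lambda\iota)$ is a Krein space continuously embedded in $H$, if and only if $\Omega$ is solvable w.r.t. an inner product, $\mathfrak n_\Omega\subseteq\mathbb R$ and $-\lambda\iota\in\mathfrak P(\Omega)$ for some $\lambda\in\mathbb R$. 2. (Grubišić–Kostrykin–Makarov–Veselić.) $\Omega(\xi,\eta)=\langle QG\xi,G\eta\rangle$ on $D$ for some positive self-adjoint operator $G$ with $D(G)=D$, $0\in\rho(G)$, and some bounded self-adjoint $Q$ with $0\in\rho(Q)$, if and only if $\Omega$ is solvable w.r.t. an inner product, $\mathfrak n_\Omega\subseteq\mathbb R$ and $\vartheta\in\mathfrak P(\Omega)$. 3. (Kato's first theorem, symmetric case.) $\Omega$ is symmetric, sectorial and closed in Kato's sense (see 4)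 if and only if $\Omega$ is solvable and $\mathfrak n_\Omega\subseteq[\omega,+\infty)$ for some $\omega\in\mathbb R$. 4. (Kato's first theorem.) $\Omega$ is sectorial (its numerical range lies in some sector $S_{\gamma,\theta}=\{z\in\mathbb C:|\arg(z-\gamma)|\le\theta\}$, which includes its vertex, with $\gamma\in\mathbb R$, $0\le\theta<\frac\pi2$) and closed (if $u_n\in D$, $u_n\to x$ in $H$ and $\Omega(u_n-u_m,u_n-u_m)\to0$, then $x\in D$ and $\Omega(u_n-x,u_n-x)\to0$), if and only if $\Omega$ is solvable w.r.t. an inner product and there are $\gamma\in\mathbb R$, $0\le\theta<\frac\pi2$ with $\mathfrak n_\Omega\subseteq S_{\gamma,\theta}$ and $-\lambda\iota\in\mathfrak P(\Omega)$ for some $\lambda\notin S_{\gamma,\theta}$. 5. (McIntosh, accretive forms.) Call a form $\Phi$ on $D$ *$0$-closed* if there is a Hilbert space structure on $D$, with norm $\|\cdot\|_D$, on which $\Phi$ is bounded and, for some $c>0$ and all $\xi\in D$, the functionals $\Phi(\xi,\cdot)$ and $\Phi(\cdot,\xi)$ have norm at least $c\|\xi\|_D$. Then $\operatorname{Re}\Omega(\xi,\xi)\ge0$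 for all $\xi\in D$ and $\Omega+\iota$ is $0$-closed, if and only if $\Omega$ is solvable w.r.t. an inner product, $\mathfrak n_\Omega\subseteq\{\operatorname{Re}z\ge0\}$ and $\iota\in\mathfrak P(\Omega)$. These conditions hold in particular if $\Omega$ is solvable w.r.t. an inner product, $\mathfrak n_\Omega\subseteq\{\operatorname{Re}z\ge0\}$ and $-i\iota\in\mathfrak P(\Omega)$. 6. (McIntosh, general forms.) $\Omega-\lambda\iota$ is $0$-closed for some $\lambda\in\mathbb C$ if and only if $\Omega$ is solvable w.r.t. an inner product and $-\lambda\iota\in\mathfrak P(\Omega)$ for some $\lambda\in\mathbb C$. 7. (Schmitz.) (a) If $K$ is a bounded self-adjoint operator on $H$ and $\Omega+\langle K\cdot,\cdot\rangle$ has the form described in 2, then $\Omega$ is solvable w.r.t. an inner product, $\mathfrak n_\Omega\subseteq\mathbb R$ and $\langle K\cdot,\cdot\rangle\in\mathfrak P(\Omega)$. (b) If $\Omega(\xi,\eta)=\langle JS\xi,S\eta\rangle+v(\xi,\eta)$ on $D$, where $S$ is positive self-adjoint with $D(S)=D$, $J$ is a bounded self-adjoint involution with $JD\subseteq D$ and $SJ=JS$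 on $D$, and $v$ is a symmetric form on $D$ with $v(J\xi,J\eta)=-v(\xi,\eta)$ and $|v(\xi,\xi)|\le\beta(\|S\xi\|^2+\|\xi\|^2)$ for some $\beta$, then $\Omega$ is solvable w.r.t. an inner product, $\mathfrak n_\Omega\subseteq\mathbb R$ and $\langle J\cdot,\cdot\rangle\in\mathfrak P(\Omega)$. (c) In general this bounded form is not a multiple of the inner product: there are a form on a dense subspace of $\ell^2(\mathbb N)$ and an operator $J$ that satisfy the hypotheses of (b) and, with $K=J$, of (a), such that $\langle J\cdot,\cdot\rangle$ is not a multiple of $\iota$ and no real multiple of $\iota$ belongs to the set $\mathfrak P$ of that form w.r.t. any inner product for which it is solvable. 8. (Lions, Schmüdgen.) If for some Hilbert space structure on $D$, with norm $\|\cdot\|_D$, the form $\Omega$ is bounded and $|\Omega(\xi,\xi)|\ge c\|\xi\|_D^2$ for all $\xi\in D$ and some $c>0$, then $\Omega$ is solvable w.r.t. an inner product, $\vartheta\in\mathfrak P(\Omega)$, and $\mathfrak n_\Omega$ is contained in a closed half-plane $\{z:\operatorname{Re}(uz)\ge c'\}$ with $|u|=1$, $c'>0$ (so not containing $0$). -/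

import Mathlib

open Filter Topology
open scoped ComplexConjugate

namespace SolvableForms

section Norms

variable {V : Type*} [AddCommGroup V] [Module ℂ V]

/-- Sesquilinear forms on `V`: linear in the first and conjugate linear in the second variable. -/
abbrev SForm (V : Type*) [AddCommGroup V] [Module ℂ V] : Type _ := V →ₗ[ℂ] V →ₗ⋆[ℂ] ℂ

/-- A norm on a complex vector space `V`. -/
structure NormOn (V : Type*) [AddCommGroup V] [Module ℂ V] extends Seminorm ℂ V where
  definite : ∀ x, toFun x = 0 → x = 0

noncomputable instance : CoeFun (NormOn V) (fun _ => V → ℝ) := ⟨fun N => N.toSeminorm⟩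

/-- The vector space `V` regarded as a normed space with the norm `N`, written `V[N]`. -/
def NormOn.Space (_N : NormOn V) : Type _ := V

namespace NormOn

variable (N : NormOn V)

/-- The identity map from `V` to `V[N]`. -/
def of (x : V) : N.Space := x

/-- The identity map from `V[N]` to `V`. -/
def out (x : N.Space) : V := x

noncomputable instance : NormedAddCommGroup N.Space :=
  @AddGroupNorm.toNormedAddCommGroup V _
    { N.toSeminorm.toAddGroupSeminorm with
      eq_zero_of_map_eq_zero' := N.definite }

instance : Module ℂ N.Space := inferInstanceAs (Module ℂ V)

theorem norm_of (x : V) : ‖N.of x‖ = N x := rfl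

noncomputable instance : NormedSpace ℂ N.Space where
  norm_smul_le a x := le_of_eq (N.toSeminorm.smul' a x)

/-- The norm `N` is induced by an inner product (a Hilbert norm, when `V[N]` is complete). -/
def IsInduced : Prop :=
  ∃ s : SForm V, (∀ x y, s y x = conj (s x y)) ∧ ∀ x, s x x = ((N x ^ 2 : ℝ) : ℂ)

/-- `V[N]` is a reflexive Banach space: it is complete and the canonical embedding into the
bidual is onto. -/
def IsReflexiveBanach : Prop :=
  CompleteSpace N.Space ∧ Function.Surjective (NormedSpace.inclusionInDoubleDual ℂ N.Space)

end NormOn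

end Norms

section Forms

variable {H : Type*} [NormedAddCommGroup H] [InnerProductSpace ℂ H]

/-- Bounded sesquilinear forms on the whole space `H`. -/
abbrev BForm (H : Type*) [NormedAddCommGroup H] [InnerProductSpace ℂ H] : Type _ :=
  H →L[ℂ] H →L⋆[ℂ] ℂ

/-- The bounded form `(ξ, η) ↦ ⟨B ξ, η⟩`. (Mathlib's `inner` is conjugate linear in its first
argument, so `⟨ξ, η⟩` is `inner ℂ η ξ`.) -/
noncomputable def opForm (B : H →L[ℂ] H) : BForm H := (innerSL ℂ).flip.comp B

theorem opForm_apply (B : H →L[ℂ] H) (x y : H) : opForm B x y = inner ℂ y (B x) := rfl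

/-- The form `ι(ξ, η) = ⟨ξ, η⟩`. -/
noncomputable def iota : BForm H := opForm (ContinuousLinearMap.id ℂ H)

variable {D : Submodule ℂ H}

/-- Restriction of a bounded form to the subspace `D`. -/
noncomputable def restrict (D : Submodule ℂ H) (U : BForm H) : SForm D :=
  LinearMap.mk₂'ₛₗ (RingHom.id ℂ) (starRingEnd ℂ) (fun x y : D => U x y)
    (fun x y z => by simp) (fun c x y => by simp) (fun x y z => by simp)
    (fun c x y => by simp)

theorem restrict_apply (U : BForm H) (x y : D) : restrict D U x y = U x y := rfl

/-- `Ω` is symmetric: it coincides with its adjoint form. -/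
def IsSymmetric (Ω : SForm D) : Prop := ∀ ξ η, Ω ξ η = conj (Ω η ξ)

/-- The numerical range of `Ω`. -/
def numRange (Ω : SForm D) : Set ℂ := {z | ∃ ξ : D, ‖(ξ : H)‖ = 1 ∧ Ω ξ ξ = z}

/-- The embedding of `D[N]` into `H` is continuous. -/
def EmbedsContinuously (N : NormOn D) : Prop := ∃ C : ℝ, ∀ ξ : D, ‖(ξ : H)‖ ≤ C * N ξ

/-- `Ω` is bounded on `D[N]`. -/
def IsBoundedOn (Ω : SForm D) (N : NormOn D) : Prop :=
  ∃ β : ℝ, 0 ≤ β ∧ ∀ ξ η, ‖Ω ξ η‖ ≤ β * N ξ * N η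

/-- `Ω` is q-closed with respect to the norm `N` on `D`. -/
structure IsQClosed (Ω : SForm D) (N : NormOn D) : Prop where
  reflexive : N.IsReflexiveBanach
  embeds : EmbedsContinuously N
  bounded : IsBoundedOn Ω N

/-- The set `P(Ω)` (for `Ω` q-closed with respect to `N`): the bounded forms `U` on `H` such that
`ξ ↦ (Ω + U)(ξ, ·)` is injective on `D` and every bounded conjugate linear functional on `D[N]`
is of the form `(Ω + U)(ξ, ·)` with `ξ ∈ D`. -/
def perturbations (Ω : SForm D) (N : NormOn D) : Set (BForm H) :=
  {U | (∀ ξ : D, (∀ η, (Ω + restrict D U) ξ η = 0) → ξ = 0) ∧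
    ∀ L : N.Space →L⋆[ℂ] ℂ, ∃ ξ : D, ∀ η : D, L (N.of η) = (Ω + restrict D U) ξ η}

/-- `Ω` is solvable with respect to the norm `N`. -/
def IsSolvable (Ω : SForm D) (N : NormOn D) : Prop :=
  IsQClosed Ω N ∧ (perturbations Ω N).Nonempty

/-- `Ω` is solvable with respect to the inner product that induces `N`. -/
def IsSolvableInner (Ω : SForm D) (N : NormOn D) : Prop := N.IsInduced ∧ IsSolvable Ω N

/-- `D[N]` is a Hilbert space that is continuously embedded in `H`. -/
structure IsEmbeddedHilbert (N : NormOn D) : Prop where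
  induced : N.IsInduced
  complete : CompleteSpace N.Space
  embeds : EmbedsContinuously N

/-! ### The first theorem of Kato: closed sectorial forms -/

/-- The sector with real vertex `γ` and half-angle `θ` around the half-line `[γ, ∞)`. -/
def sector (γ θ : ℝ) : Set ℂ := {z | |(z - γ).arg| ≤ θ}

/-- `Ω` is sectorial. -/
def IsSectorial (Ω : SForm D) : Prop :=
  ∃ γ θ : ℝ, 0 ≤ θ ∧ θ < Real.pi / 2 ∧ numRange Ω ⊆ sector γ θ

/-- `Ω` is closed in the sense of Kato: if `u n ∈ D`, `u n → x` in `H` and `Ω[u n - u m] → 0`,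
then `x ∈ D` and `Ω[u n - x] → 0`. -/
def IsKatoClosed (Ω : SForm D) : Prop :=
  ∀ (u : ℕ → D) (x : H), Tendsto (fun n => (u n : H)) atTop (𝓝 x) →
    Tendsto (fun p : ℕ × ℕ => Ω (u p.1 - u p.2) (u p.1 - u p.2)) atTop (𝓝 0) →
    ∃ y : D, (y : H) = x ∧ Tendsto (fun n => Ω (u n - y) (u n - y)) atTop (𝓝 0)

/-- The hypotheses of Kato's first representation theorem (`D` is dense throughout). -/
def IsKatoForm (Ω : SForm D) : Prop := IsSectorial Ω ∧ IsKatoClosed Ω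

/-! ### Fleige, Hassi and de Snoo: symmetric forms with a gap point -/

/-- `(D, Φ)` is a Krein space that is continuously embedded in `H`: `D` is the direct,
`Φ`-orthogonal sum of `P` and `M`, the spaces `(P, Φ)` and `(M, -Φ)` are Hilbert spaces, and the
norm `N (p + m) = (Φ(p, p) - Φ(m, m))^(1/2)` of this decomposition dominates the norm of `H`. -/
def IsEmbeddedKrein (Φ : SForm D) : Prop :=
  IsSymmetric Φ ∧ ∃ (P M : Submodule ℂ D) (N : NormOn D),
    IsCompl P M ∧ (∀ p ∈ P, ∀ m ∈ M, Φ p m = 0) ∧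
    (∀ p ∈ P, p ≠ 0 → 0 < (Φ p p).re) ∧ (∀ m ∈ M, m ≠ 0 → (Φ m m).re < 0) ∧
    (∀ p ∈ P, ∀ m ∈ M, N (p + m) ^ 2 = (Φ p p).re - (Φ m m).re) ∧
    IsComplete (N.of '' (P : Set D)) ∧ IsComplete (N.of '' (M : Set D)) ∧
    EmbedsContinuously N

/-- `Ω` is symmetric and has a real gap point `l`: `(D, Ω - l ι)` is a Krein space continuously
embedded in `H`. -/
def IsFHSForm (Ω : SForm D) : Prop :=
  IsSymmetric Ω ∧ ∃ l : ℝ, IsEmbeddedKrein (Ω + restrict D (-(l : ℂ) • iota))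

/-! ### Grubišić, Kostrykin, Makarov and Veselić -/

/-- The (possibly unbounded) operator `G` is positive and self-adjoint with domain `D`. -/
structure IsPositiveSAOn (G : H →ₗ.[ℂ] H) [CompleteSpace H] (D : Submodule ℂ H) : Prop where
  domain_eq : G.domain = D
  selfAdjoint : IsSelfAdjoint G
  nonneg : ∀ x : G.domain, 0 ≤ (inner ℂ (x : H) (G x)).re

/-- `0` is in the resolvent set of `G`: `G` has an everywhere defined bounded inverse. -/
def ZeroMemResolvent (G : H →ₗ.[ℂ] H) : Prop :=
  ∃ R : H →L[ℂ] H, (∀ x : G.domain, R (G x) = x) ∧ ∀ y, ∃ x : G.domain, (x : H) = R y ∧ G x = y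

/-- `Φ(ξ, η) = ⟨Q G ξ, G η⟩` on `D = D(G)`, where `G` (the operator `A^(1/2)`) is positive and
self-adjoint with `0 ∈ ρ(G)`, and `Q` is bounded and self-adjoint with `0 ∈ ρ(Q)`. -/
def IsGKMVForm [CompleteSpace H] (Φ : SForm D) : Prop :=
  ∃ (G : H →ₗ.[ℂ] H) (Q : H →L[ℂ] H), IsPositiveSAOn G D ∧ ZeroMemResolvent G ∧
    IsSelfAdjoint Q ∧ IsUnit Q ∧
    ∀ x y : G.domain, ∀ ξ η : D, (ξ : H) = x → (η : H) = y → Φ ξ η = inner ℂ (G y) (Q (G x))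

/-! ### Schmitz: indefinite forms without spectral gap -/

/-- `Ω` becomes a form `⟨Q G ·, G ·⟩` as above after adding the bounded symmetric form
`⟨K ·, ·⟩`. -/
def IsSchmitzForm [CompleteSpace H] (Ω : SForm D) (K : H →L[ℂ] H) : Prop :=
  IsSelfAdjoint K ∧ IsGKMVForm (Ω + restrict D (opForm K))

/-- `Ω(ξ, η) = ⟨J S ξ, S η⟩ + v(ξ, η)` where `S` (the operator `A^(1/2)`) is positive and
self-adjoint with domain `D`, `J` is a self-adjoint involution commuting with `S`, and `v` is a
symmetric form on `D` which is off-diagonal with respect to `J` and form bounded with respect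
to `S`. -/
def IsOffDiagonalForm [CompleteSpace H] (Ω : SForm D) (J : H →L[ℂ] H) : Prop :=
  IsSelfAdjoint J ∧ (∀ x, J (J x) = x) ∧
  ∃ (S : H →ₗ.[ℂ] H) (v : SForm D), IsPositiveSAOn S D ∧
    (∀ x : S.domain, ∃ y : S.domain, (y : H) = J x ∧ S y = J (S x)) ∧
    IsSymmetric v ∧
    (∀ ξ η ξ' η' : D, (ξ' : H) = J ξ → (η' : H) = J η → v ξ' η' = - v ξ η) ∧
    (∃ β : ℝ, ∀ x : S.domain, ∀ ξ : D, (ξ : H) = x →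
      ‖v ξ ξ‖ ≤ β * (‖S x‖ ^ 2 + ‖(x : H)‖ ^ 2)) ∧
    ∀ x y : S.domain, ∀ ξ η : D, (ξ : H) = x → (η : H) = y →
      Ω ξ η = inner ℂ (S y) (J (S x)) + v ξ η

/-! ### McIntosh: `λ`-closed forms -/

/-- `Φ` is `0`-closed: `D` is a Hilbert space continuously embedded in `H` on which `Φ` is bounded
and satisfies inf-sup conditions in both variables, i.e. the functionals `Φ(ξ, ·)` and `Φ(·, ξ)`
on this Hilbert space have norm at least `c N(ξ)`. -/
def IsZeroClosed (Φ : SForm D) : Prop :=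
  ∃ N : NormOn D, IsEmbeddedHilbert N ∧ IsBoundedOn Φ N ∧ ∃ c : ℝ, 0 < c ∧
    (∀ (ξ : D) (M : ℝ), 0 ≤ M → (∀ η, ‖Φ ξ η‖ ≤ M * N η) → c * N ξ ≤ M) ∧
    (∀ (ξ : D) (M : ℝ), 0 ≤ M → (∀ η, ‖Φ η ξ‖ ≤ M * N η) → c * N ξ ≤ M)

/-- Closed accretive forms: `Re Ω(ξ, ξ) ≥ 0` and `Ω + ι` is `0`-closed. -/
def IsClosedAccretive (Ω : SForm D) : Prop :=
  (∀ ξ, 0 ≤ (Ω ξ ξ).re) ∧ IsZeroClosed (Ω + restrict D iota)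

/-- `Ω` is `l`-closed for some complex `l`, i.e. `Ω - l ι` is `0`-closed. -/
def IsMcIntoshForm (Ω : SForm D) : Prop :=
  ∃ l : ℂ, IsZeroClosed (Ω + restrict D (-l • iota))

/-! ### Lions, Schmüdgen: bounded coercive forms -/

/-- `D` is a Hilbert space continuously embedded in `H` on which `Ω` is bounded and coercive. -/
def IsLionsForm (Ω : SForm D) : Prop :=
  ∃ N : NormOn D, IsEmbeddedHilbert N ∧ IsBoundedOn Ω N ∧
    ∃ c : ℝ, 0 < c ∧ ∀ ξ, c * N ξ ^ 2 ≤ ‖Ω ξ ξ‖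

end Forms

end SolvableForms

namespace SolvableForms

/-! Absorb the bounded form into the given one, `Φ = Ω + U`. Then `U ∈ perturbations Ω N` says that
`ξ ↦ Φ(ξ, ·)` is a bijection from `D[N]` onto its conjugate dual. By the bounded inverse theorem
this yields a lower bound for the functionals `Φ(ξ, ·)` (`exists_isBoundedBelow`). Conversely, for a
Hilbert norm, such a lower bound together with nondegeneracy in the second variable gives the
bijection back (`zero_mem_perturbations_of_boundedBelow`). Hence `0`-closedness of `Ω + U` and
solvability with `U` in the set of perturbations are the same thing
(`isZeroClosed_add_restrict_iff`), which is McIntosh's case.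

The implications from the classical hypotheses to solvability amount to finding a Hilbert norm on
`D` for which the lower bound is visible: the shifted real part for Kato, the norm of a fundamental
decomposition for Krein spaces, `‖G ·‖` for forms `⟨Q G ·, G ·⟩`, the graph norm of `S` for
off-diagonal perturbations. Coercive forms come with such a norm, and the half-plane is found by
separating their convex numerical range from `0`.

In the opposite direction a symmetric `Φ` is given on `D[N]` by an invertible self-adjoint operator
`T`. The polar decomposition of `T` splits `D` into the two parts of a Krein space. The polar
decomposition of the embedding `D[N] → H` yields `G` and a unitary map that carries `T` to `Q`. For
Kato forms, every norm that makes a sectorial form solvable is equivalent to the norm built from its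
real part, so completeness yields closedness (`IsSectorialWith.isKatoClosed`); a Banach norm is
enough for this.

The example is a diagonal form on `ℓ²(ℕ)` with entries dense in the real line. No real shift is
bounded below, but adding the signs of the entries moves all of them away from `0`. -/

/-- The representation theorem of Riesz for bounded conjugate linear functionals. -/
theorem exists_eq_inner {E : Type*} [NormedAddCommGroup E] [InnerProductSpace ℂ E]
    [CompleteSpace E] (L : E →L⋆[ℂ] ℂ) : ∃ z : E, ∀ x, L x = inner ℂ x z := by
  let g : StrongDual ℂ E :=
    { toFun := fun x => conj (L x)
      map_add' := fun x y => by simp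
      map_smul' := fun c x => by simp
      cont := by fun_prop }
  obtain ⟨z, hz⟩ := (InnerProductSpace.toDual ℂ E).surjective g
  refine ⟨z, fun x => ?_⟩
  have h : inner ℂ z x = conj (L x) := by
    rw [← InnerProductSpace.toDual_apply_apply, hz]; rfl
  rw [← inner_conj_symm, h, Complex.conj_conj]

/-! ### Norms induced by an inner product -/

section Norms

variable {V : Type*} [AddCommGroup V] [Module ℂ V]

namespace NormOn

variable (N : NormOn V)

theorem nonneg (x : V) : 0 ≤ N x := apply_nonneg N.toSeminorm x

theorem pos {x : V} (hx : x ≠ 0) : 0 < N x :=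
  lt_of_le_of_ne (N.nonneg x) fun h => hx (N.definite x h.symm)

/-- The identity map from `V` to `V[N]` as a linear equivalence. -/
def ofₗ : V ≃ₗ[ℂ] N.Space where
  toFun := N.of
  invFun := N.out
  map_add' _ _ := rfl
  map_smul' _ _ := rfl
  left_inv _ := rfl
  right_inv _ := rfl

/-- The inner product that induces `N`. -/
noncomputable instance innerProductSpace [h : Fact N.IsInduced] : InnerProductSpace ℂ N.Space :=
  { (inferInstance : NormedSpace ℂ N.Space) with
    inner := fun x y => h.out.choose (N.out y) (N.out x)
    norm_sq_eq_re_inner := fun x => by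
      have := h.out.choose_spec.2 (N.out x)
      change N (N.out x) ^ 2 = (h.out.choose (N.out x) (N.out x)).re
      rw [this, Complex.ofReal_re]
    conj_inner_symm := fun x y => (h.out.choose_spec.1 (N.out x) (N.out y)).symm
    add_left := fun x y z => map_add (h.out.choose (N.out z)) (N.out x) (N.out y)
    smul_left := fun x y r => map_smulₛₗ (h.out.choose (N.out y)) r (N.out x) }

theorem isInduced_of_inner (s : SForm V) (hs : ∀ x y, s y x = conj (s x y))
    (hN : ∀ x, N x ^ 2 = (s x x).re) : N.IsInduced :=
  ⟨s, hs, fun x => by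
    rw [hN]; exact (Complex.conj_eq_iff_re.1 (hs x x).symm).symm⟩

/-- The Riesz map onto the dual is conjugate linear, so composing it with a functional on the dual
gives a conjugate linear functional on the space itself. A second use of Riesz then provides the
preimage. -/
theorem isReflexiveBanach_of_hilbert (h : N.IsInduced) (hc : CompleteSpace N.Space) :
    N.IsReflexiveBanach := by
  have : Fact N.IsInduced := ⟨h⟩
  refine ⟨hc, fun F => ?_⟩
  obtain ⟨z, hz⟩ := exists_eq_inner
    (F.comp (InnerProductSpace.toDual ℂ N.Space).toContinuousLinearEquiv.toContinuousLinearMap)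
  refine ⟨z, ?_⟩
  ext φ
  obtain ⟨y, rfl⟩ := (InnerProductSpace.toDual ℂ N.Space).surjective φ
  rw [NormedSpace.dual_def, InnerProductSpace.toDual_apply_apply, ← hz]
  rfl

end NormOn

section OfForm

variable (s : SForm V) (hs : ∀ x y, s y x = conj (s x y)) (hpos : ∀ x, x ≠ 0 → 0 < (s x x).re)

/-- The inner product space structure defined by a positive definite form. -/
abbrev coreOfForm : InnerProductSpace.Core ℂ V where
  inner x y := s y x
  conj_inner_symm x y := (hs x y).symm
  re_inner_nonneg x := by
    rcases eq_or_ne x 0 with rfl | hx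
    · simp
    · exact (hpos x hx).le
  add_left x y z := map_add (s z) x y
  smul_left x y r := map_smulₛₗ (s y) r x
  definite x hx := by
    by_contra h
    have := hpos x h
    rw [hx] at this
    simp at this

/-- The norm induced by a positive definite form. -/
noncomputable def NormOn.ofForm : NormOn V :=
  letI := (coreOfForm s hs hpos).toNormedAddCommGroup
  letI := InnerProductSpace.ofCore (coreOfForm s hs hpos).toCore
  { normSeminorm ℂ V with
    definite := fun _ hx => norm_eq_zero.1 hx }

theorem NormOn.ofForm_sq (x : V) : NormOn.ofForm s hs hpos x ^ 2 = (s x x).re := by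
  let := (coreOfForm s hs hpos).toNormedAddCommGroup
  let := InnerProductSpace.ofCore (coreOfForm s hs hpos).toCore
  exact (norm_sq_eq_re_inner (𝕜 := ℂ) x)

theorem NormOn.ofForm_isInduced : (NormOn.ofForm s hs hpos).IsInduced :=
  NormOn.isInduced_of_inner _ s hs (NormOn.ofForm_sq s hs hpos)

end OfForm

end Norms

theorem norm_inner_self_eq {E : Type*} [NormedAddCommGroup E] [InnerProductSpace ℂ E] (x : E) :
    ‖inner ℂ x x‖ = ‖x‖ * ‖x‖ := by
  rw [inner_self_eq_norm_sq_to_K, norm_pow, RCLike.norm_ofReal, abs_norm, sq]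

section Forms

variable {H : Type*} [NormedAddCommGroup H] [InnerProductSpace ℂ H] {D : Submodule ℂ H}

/-! ### Bounded forms -/

/-- This reduces all criteria for membership to the null form. -/
theorem mem_perturbations_iff {Ω : SForm D} {N : NormOn D} {U : BForm H} :
    U ∈ perturbations Ω N ↔ 0 ∈ perturbations (Ω + restrict D U) N := by
  have h : Ω + restrict D U + restrict D 0 = Ω + restrict D U := by
    ext x y
    simp [restrict_apply]
  simp only [perturbations, Set.mem_ofPred_eq, h]

theorem zero_mem_perturbations_iff {Ω : SForm D} {N : NormOn D} :
    0 ∈ perturbations Ω N ↔ (∀ ξ : D, (∀ η, Ω ξ η = 0) → ξ = 0) ∧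
      ∀ L : N.Space →L⋆[ℂ] ℂ, ∃ ξ : D, ∀ η : D, L (N.of η) = Ω ξ η := by
  have h : Ω + restrict D 0 = Ω := by
    ext x y
    simp [restrict_apply]
  simp only [perturbations, Set.mem_ofPred_eq, h]

theorem EmbedsContinuously.exists_pos {N : NormOn D} (h : EmbedsContinuously N) :
    ∃ C : ℝ, 0 < C ∧ ∀ ξ : D, ‖(ξ : H)‖ ≤ C * N ξ := by
  obtain ⟨C, hC⟩ := h
  refine ⟨max C 1, by positivity, fun ξ => (hC ξ).trans ?_⟩
  exact mul_le_mul_of_nonneg_right (le_max_left _ _) (N.nonneg ξ)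

theorem isBoundedOn_restrict {N : NormOn D} (h : EmbedsContinuously N) (U : BForm H) :
    IsBoundedOn (restrict D U) N := by
  obtain ⟨C, hC0, hC⟩ := h.exists_pos
  refine ⟨‖U‖ * C * C, by positivity, fun ξ η => ?_⟩
  calc ‖U ξ η‖ ≤ ‖U‖ * ‖(ξ : H)‖ * ‖(η : H)‖ := U.le_opNorm₂ _ _
    _ ≤ ‖U‖ * (C * N ξ) * (C * N η) := by gcongr <;> apply hC
    _ = _ := by ring

theorem IsBoundedOn.add {N : NormOn D} {Φ Ψ : SForm D} (h : IsBoundedOn Φ N)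
    (h' : IsBoundedOn Ψ N) : IsBoundedOn (Φ + Ψ) N := by
  obtain ⟨a, ha0, ha⟩ := h
  obtain ⟨b, hb0, hb⟩ := h'
  refine ⟨a + b, by positivity, fun ξ η => ?_⟩
  calc ‖Φ ξ η + Ψ ξ η‖ ≤ ‖Φ ξ η‖ + ‖Ψ ξ η‖ := norm_add_le _ _
    _ ≤ _ := add_le_add (ha ξ η) (hb ξ η)
    _ = _ := by ring

theorem isBoundedOn_add_restrict_iff {N : NormOn D} (h : EmbedsContinuously N) (U : BForm H)
    {Ω : SForm D} : IsBoundedOn (Ω + restrict D U) N ↔ IsBoundedOn Ω N := by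
  refine ⟨fun hb => ?_, fun hb => hb.add (isBoundedOn_restrict h U)⟩
  have := hb.add (isBoundedOn_restrict h (-U))
  convert this using 1
  ext x y
  simp [restrict_apply]

/-- A form whose diagonal is dominated by a norm is bounded with respect to this norm. -/
theorem isBoundedOn_of_diag {N : NormOn D} {Φ : SForm D} {b : ℝ} (hb : 0 ≤ b)
    (h : ∀ ξ, ‖Φ ξ ξ‖ ≤ b * N ξ ^ 2) : IsBoundedOn Φ N := by
  have key : ∀ ξ η, N ξ = 1 → N η = 1 → ‖Φ ξ η‖ ≤ 4 * b := by
    intro ξ η hξ hη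
    -- Polarization: for unit vectors the four arguments have norm at most 2, so each diagonal term
    -- is at most `4 * b`.
    have hpol : (4 : ℂ) * Φ ξ η = Φ (ξ + η) (ξ + η) - Φ (ξ - η) (ξ - η)
        + Complex.I * Φ (ξ + Complex.I • η) (ξ + Complex.I • η)
        - Complex.I * Φ (ξ - Complex.I • η) (ξ - Complex.I • η) := by
      simp only [map_add, map_sub, map_smul, LinearMap.add_apply, LinearMap.sub_apply,
        LinearMap.smul_apply, map_smulₛₗ, smul_eq_mul, Complex.conj_I]
      linear_combination (2 * Φ ξ η - 2 * Φ η ξ) * Complex.I_sq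
    have h1 : ∀ ζ : D, N ζ ≤ 2 → ‖Φ ζ ζ‖ ≤ 4 * b := fun ζ hζ => by
      have := N.nonneg ζ
      calc ‖Φ ζ ζ‖ ≤ b * N ζ ^ 2 := h ζ
        _ ≤ b * 2 ^ 2 := by gcongr
        _ = _ := by ring
    have hI : N (Complex.I • η) = 1 := by
      have := map_smul_eq_mul N.toSeminorm Complex.I η
      simpa [hη] using this
    have hadd : ∀ x y : D, N x = 1 → N y = 1 → N (x + y) ≤ 2 := fun x y hx hy => by
      have := map_add_le_add N.toSeminorm x y
      change N (x + y) ≤ N x + N y at this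
      linarith
    have hsub : ∀ x y : D, N x = 1 → N y = 1 → N (x - y) ≤ 2 := fun x y hx hy => by
      have := map_sub_le_add N.toSeminorm x y
      change N (x - y) ≤ N x + N y at this
      linarith
    have hn : ‖(4 : ℂ) * Φ ξ η‖ ≤ 4 * b + 4 * b + 4 * b + 4 * b := by
      rw [hpol]
      refine (norm_sub_le _ _).trans (add_le_add ((norm_add_le _ _).trans (add_le_add
        ((norm_sub_le _ _).trans (add_le_add ?_ ?_)) ?_)) ?_)
      · exact h1 _ (hadd _ _ hξ hη)
      · exact h1 _ (hsub _ _ hξ hη)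
      · rw [norm_mul, Complex.norm_I, one_mul]; exact h1 _ (hadd _ _ hξ hI)
      · rw [norm_mul, Complex.norm_I, one_mul]; exact h1 _ (hsub _ _ hξ hI)
    rw [norm_mul] at hn
    norm_num at hn
    linarith
  refine ⟨4 * b, by positivity, fun ξ η => ?_⟩
  rcases eq_or_ne ξ 0 with rfl | hξ
  · simp only [map_zero, LinearMap.zero_apply, norm_zero]
    have := N.nonneg 0; have := N.nonneg η; positivity
  rcases eq_or_ne η 0 with rfl | hη
  · simp only [map_zero, norm_zero]
    have := N.nonneg 0; have := N.nonneg ξ; positivity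
  have hξ := N.pos hξ
  have hη := N.pos hη
  have hnorm : ∀ x : D, 0 < N x → N (((N x : ℂ)⁻¹) • x) = 1 := fun x hx => by
    have := map_smul_eq_mul N.toSeminorm ((N x : ℂ)⁻¹) x
    change N (((N x : ℂ)⁻¹) • x) = _ * N x at this
    rw [this, norm_inv, Complex.norm_real, Real.norm_of_nonneg hx.le, inv_mul_cancel₀ hx.ne']
  have := key _ _ (hnorm ξ hξ) (hnorm η hη)
  simp only [map_smul, map_smulₛₗ, LinearMap.smul_apply, smul_eq_mul, norm_mul, norm_inv,
    RingHomIsometric.norm_map, Complex.norm_real, Real.norm_of_nonneg hξ.le,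
    Real.norm_of_nonneg hη.le] at this
  rw [inv_mul_le_iff₀ hη, inv_mul_le_iff₀ hξ] at this
  linarith

/-! ### Forms and operators on a Hilbert space structure -/

/-- The functionals `Φ(ξ, ·)` on `D[N]` have norm at least `C⁻¹ N(ξ)`. -/
def IsBoundedBelow (Φ : SForm D) (N : NormOn D) (C : ℝ) : Prop :=
  ∀ (ξ : D) (M : ℝ), 0 ≤ M → (∀ η, ‖Φ ξ η‖ ≤ M * N η) → N ξ ≤ C * M

/-- The two defining conditions make `ξ ↦ Φ(ξ, ·)` a continuous bijection between Banach spaces, so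
its inverse is bounded. No inner product is involved, which the symmetric Kato case relies on. -/
theorem exists_isBoundedBelow {Φ : SForm D} {N : NormOn D} (hc : CompleteSpace N.Space)
    (hb : IsBoundedOn Φ N) (h : 0 ∈ perturbations Φ N) :
    ∃ C : ℝ, 0 < C ∧ IsBoundedBelow Φ N C := by
  obtain ⟨β, -, hβ⟩ := hb
  rw [zero_mem_perturbations_iff] at h
  let T : N.Space →L[ℂ] N.Space →L⋆[ℂ] ℂ :=
    LinearMap.mkContinuous₂ (LinearMap.mk₂'ₛₗ (RingHom.id ℂ) (starRingEnd ℂ)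
      (fun x y : N.Space => Φ (N.out x) (N.out y))
      (fun x y z => LinearMap.congr_fun (map_add Φ (N.out x) (N.out y)) (N.out z))
      (fun c x y => LinearMap.congr_fun (map_smul Φ c (N.out x)) (N.out y))
      (fun x y z => map_add (Φ (N.out x)) (N.out y) (N.out z))
      (fun c x y => map_smulₛₗ (Φ (N.out x)) c (N.out y))) β (fun x y => hβ x y)
  have hT : ∀ x y : N.Space, T x y = Φ (N.out x) (N.out y) := fun _ _ => rfl
  have hker : T.ker = ⊥ := LinearMap.ker_eq_bot'.2 fun x hx => h.1 x fun y =>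
    (hT x y).symm.trans (congrArg (fun f : N.Space →L⋆[ℂ] ℂ => f y) hx)
  have hran : T.range = ⊤ := LinearMap.range_eq_top.2 fun L => by
    obtain ⟨ξ, hξ⟩ := h.2 L
    exact ⟨ξ, ContinuousLinearMap.ext fun y => (hξ y).symm⟩
  let e := ContinuousLinearEquiv.ofBijective T hker hran
  -- The summand 1 only keeps the constant positive.
  refine ⟨‖(e.symm : (N.Space →L⋆[ℂ] ℂ) →L[ℂ] N.Space)‖ + 1, by positivity, fun ξ M hM hξ => ?_⟩
  have h1 : ‖T ξ‖ ≤ M := ContinuousLinearMap.opNorm_le_bound _ hM fun y => hξ y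
  have h2 := (e.symm : (N.Space →L⋆[ℂ] ℂ) →L[ℂ] N.Space).le_opNorm (T ξ)
  have h3 : (e.symm : (N.Space →L⋆[ℂ] ℂ) →L[ℂ] N.Space) (T ξ) = ξ := e.symm_apply_apply ξ
  rw [h3] at h2
  calc N ξ ≤ _ := h2
    _ ≤ _ := by gcongr; linarith

/-- The operator on `D[N]` associated with a bounded form. -/
theorem exists_operator {Φ : SForm D} {N : NormOn D} [Fact N.IsInduced] [CompleteSpace N.Space]
    (hb : IsBoundedOn Φ N) : ∃ T : N.Space →L[ℂ] N.Space,
      ∀ x y : N.Space, inner ℂ y (T x) = Φ (N.out x) (N.out y) := by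
  obtain ⟨β, -, hβ⟩ := hb
  have hL : ∀ x : N.Space, ∃ z : N.Space, ∀ y, Φ (N.out x) (N.out y) = inner ℂ y z := fun x =>
    exists_eq_inner (LinearMap.mkContinuous
      ({ toFun := fun y => Φ (N.out x) (N.out y)
         map_add' := fun y z => map_add (Φ (N.out x)) (N.out y) (N.out z)
         map_smul' := fun c y => map_smulₛₗ (Φ (N.out x)) c (N.out y) } : N.Space →ₗ⋆[ℂ] ℂ)
      (β * N (N.out x)) (fun y => hβ x y))
  choose t ht using hL
  refine ⟨LinearMap.mkContinuous
    { toFun := t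
      map_add' := fun x y => ext_inner_left ℂ fun z => by
        rw [inner_add_right, ← ht, ← ht, ← ht]
        exact LinearMap.congr_fun (map_add Φ (N.out x) (N.out y)) (N.out z)
      map_smul' := fun c x => ext_inner_left ℂ fun z => by
        rw [RingHom.id_apply, inner_smul_right, ← ht, ← ht]
        exact LinearMap.congr_fun (map_smul Φ c (N.out x)) (N.out z) } β (fun x => ?_),
    fun x y => (ht x y).symm⟩
  change ‖t x‖ ≤ β * ‖x‖
  rcases (norm_nonneg (t x)).eq_or_lt with h0 | h0
  -- Division by `‖t x‖` is impossible here; that `β * ‖x‖` is nonnegative is read off from the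
  -- bound at `(x, x)`.
  · rw [← h0]
    by_contra hneg
    push Not at hneg
    have h1 := hβ x x
    have h2 : (0 : ℝ) < ‖x‖ := by
      refine lt_of_le_of_ne (norm_nonneg _) fun h => ?_
      rw [← h] at hneg; simp at hneg
    have h3 := (norm_nonneg _).trans h1
    change 0 ≤ β * ‖x‖ * ‖x‖ at h3
    nlinarith
  · refine le_of_mul_le_mul_right ?_ h0
    have h1 : ‖Φ (N.out x) (N.out (t x))‖ ≤ β * ‖x‖ * ‖t x‖ := hβ x (t x)
    rwa [ht, norm_inner_self_eq] at h1

/-- The Babuška–Lax–Milgram theorem. -/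
theorem zero_mem_perturbations_of_boundedBelow {Φ : SForm D} {N : NormOn D} (hi : N.IsInduced)
    (hc : CompleteSpace N.Space) (hb : IsBoundedOn Φ N) {C : ℝ}
    (h : IsBoundedBelow Φ N C) (h0 : ∀ η, (∀ ξ, Φ ξ η = 0) → η = 0) :
    0 ∈ perturbations Φ N := by
  have : Fact N.IsInduced := ⟨hi⟩
  obtain ⟨T, hT⟩ := exists_operator hb
  have hbelow : ∀ x : N.Space, ‖x‖ ≤ C * ‖T x‖ := fun x =>
    h x _ (norm_nonneg _) fun y => by
      have h1 := norm_inner_le_norm (𝕜 := ℂ) (N.of y) (T x)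
      rw [hT] at h1
      calc ‖Φ x y‖ ≤ _ := h1
        _ = _ := mul_comm _ _
  -- The sign of `C` is not assumed, hence the maximum with 0. The lower bound makes the range of
  -- `T` closed.
  have hanti : AntilipschitzWith (max C 0).toNNReal T :=
    ContinuousLinearMap.antilipschitz_of_bound T fun x => by
      rw [Real.coe_toNNReal _ (le_max_right _ _)]
      exact (hbelow x).trans (mul_le_mul_of_nonneg_right (le_max_left _ _) (norm_nonneg _))
  have hclosed : IsClosed (Set.range T) := hanti.isClosed_range T.uniformContinuous
  have hran : T.range = ⊤ := by
    have hcl : IsClosed (T.range : Set N.Space) := hclosed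
    have : CompleteSpace T.range := hcl.completeSpace_coe
    -- A vector orthogonal to the range of `T` is annihilated by every `Φ(ξ, ·)`, so `h0` applies
    -- and the closed range is everything.
    rw [← Submodule.orthogonal_eq_bot_iff, Submodule.eq_bot_iff]
    intro w hw
    refine h0 w fun ξ => ?_
    rw [Submodule.mem_orthogonal'] at hw
    have := hw (T (N.of ξ)) ⟨_, rfl⟩
    rwa [hT] at this
  refine zero_mem_perturbations_iff.2 ⟨fun ξ hξ => ?_, fun L => ?_⟩
  · have := h ξ 0 le_rfl fun η => by simp [hξ]
    rw [mul_zero] at this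
    exact N.definite ξ (le_antisymm this (N.nonneg ξ))
  · obtain ⟨z, hz⟩ := exists_eq_inner L
    obtain ⟨x, hx⟩ := LinearMap.range_eq_top.1 hran z
    refine ⟨N.out x, fun η => ?_⟩
    rw [hz, ← hx]
    exact hT x (N.of η)

/-- The form adjoint to a form with `0 ∈ P(Φ)` is bounded below. -/
theorem norm_le_of_zero_mem_perturbations {Φ : SForm D} {N : NormOn D} (hi : N.IsInduced)
    (h : 0 ∈ perturbations Φ N) {C : ℝ} (hC : 0 < C) (hb : IsBoundedBelow Φ N C)
    (ξ : D) (M : ℝ) (hM : 0 ≤ M) (hξ : ∀ η, ‖Φ η ξ‖ ≤ M * N η) : N ξ ≤ C * M := by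
  have : Fact N.IsInduced := ⟨hi⟩
  let L : N.Space →L⋆[ℂ] ℂ := (innerSL ℂ).flip (N.of ξ)
  -- Solving `Φ(η, ·) = ⟨ξ, ·⟩` in `D[N]` gives `N ξ ^ 2 = Φ(η, ξ) ≤ M * N η`, while `N η ≤ C * N
  -- ξ`.
  obtain ⟨η, hη⟩ := (zero_mem_perturbations_iff.1 h).2 L
  have hη' : ∀ ζ : D, Φ η ζ = inner ℂ (N.of ζ) (N.of ξ) := fun ζ => (hη ζ).symm
  have h1 : N η ≤ C * N ξ := hb η _ (N.nonneg ξ) fun ζ => by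
    rw [hη', mul_comm]; exact norm_inner_le_norm (𝕜 := ℂ) (N.of ζ) (N.of ξ)
  have h2 : N ξ * N ξ ≤ M * N η := by
    have := hξ η
    rwa [hη', norm_inner_self_eq] at this
  rcases (N.nonneg ξ).eq_or_lt with h0 | h0
  · rw [← h0]; positivity
  · refine le_of_mul_le_mul_right ?_ h0
    nlinarith

theorem isQClosed_of_hilbert {Ω : SForm D} {N : NormOn D} (h : IsEmbeddedHilbert N)
    (hb : IsBoundedOn Ω N) : IsQClosed Ω N :=
  ⟨N.isReflexiveBanach_of_hilbert h.induced h.complete, h.embeds, hb⟩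

theorem IsSolvableInner.isEmbeddedHilbert {Ω : SForm D} {N : NormOn D}
    (h : IsSolvableInner Ω N) : IsEmbeddedHilbert N :=
  ⟨h.1, h.2.1.reflexive.1, h.2.1.embeds⟩

theorem IsEmbeddedHilbert.isSolvableInner {Ω : SForm D} {N : NormOn D}
    (h : IsEmbeddedHilbert N) (hb : IsBoundedOn Ω N) {U : BForm H} (hU : U ∈ perturbations Ω N) :
    IsSolvableInner Ω N :=
  ⟨h.induced, isQClosed_of_hilbert h hb, U, hU⟩

/-- A form is `0`-closed if and only if the null form belongs to `P(Φ)` for some Hilbert space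
structure on which `Φ` is bounded. -/
theorem isZeroClosed_iff {Φ : SForm D} : IsZeroClosed Φ ↔
    ∃ N, IsEmbeddedHilbert N ∧ IsBoundedOn Φ N ∧ 0 ∈ perturbations Φ N := by
  constructor
  · rintro ⟨N, hN, hb, c, hc, h1, h2⟩
    refine ⟨N, hN, hb, zero_mem_perturbations_of_boundedBelow (C := c⁻¹) hN.induced hN.complete
      hb (fun ξ M hM h => ?_) fun η hη => ?_⟩
    · rw [← div_eq_inv_mul, le_div_iff₀ hc, mul_comm]
      exact h1 ξ M hM h
    · have := h2 η 0 le_rfl fun ξ => by simp [hη]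
      refine N.definite η (le_antisymm ?_ (N.nonneg η))
      exact nonpos_of_mul_nonpos_right this hc
  · rintro ⟨N, hN, hb, h⟩
    obtain ⟨C, hC, hbl⟩ := exists_isBoundedBelow hN.complete hb h
    refine ⟨N, hN, hb, C⁻¹, by positivity, fun ξ M hM hξ => ?_, fun ξ M hM hξ => ?_⟩
    · rw [inv_mul_le_iff₀ hC]; exact hbl ξ M hM hξ
    · rw [inv_mul_le_iff₀ hC]
      exact norm_le_of_zero_mem_perturbations hN.induced h hC hbl ξ M hM hξ

/-- `Ω + U` is `0`-closed if and only if `Ω` is solvable with respect to an inner product for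
which `U` belongs to `P(Ω)`. -/
theorem isZeroClosed_add_restrict_iff {Ω : SForm D} {U : BForm H} :
    IsZeroClosed (Ω + restrict D U) ↔ ∃ N, IsSolvableInner Ω N ∧ U ∈ perturbations Ω N := by
  rw [isZeroClosed_iff]
  constructor
  · rintro ⟨N, hN, hb, h⟩
    rw [isBoundedOn_add_restrict_iff hN.embeds] at hb
    rw [← mem_perturbations_iff] at h
    exact ⟨N, hN.isSolvableInner hb h, h⟩
  · rintro ⟨N, hN, h⟩
    have hE := hN.isEmbeddedHilbert
    exact ⟨N, hE, (isBoundedOn_add_restrict_iff hE.embeds U).2 hN.2.1.bounded,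
      mem_perturbations_iff.1 h⟩

/-! ### Numerical range -/

theorem mem_numRange_of_ne_zero (Ω : SForm D) {ξ : D} (hξ : ξ ≠ 0) :
    ((‖(ξ : H)‖ ^ 2 : ℝ) : ℂ)⁻¹ * Ω ξ ξ ∈ numRange Ω := by
  have h0 : 0 < ‖(ξ : H)‖ := by simpa using hξ
  refine ⟨((‖(ξ : H)‖ : ℂ)⁻¹) • ξ, ?_, ?_⟩
  · rw [Submodule.coe_smul, norm_smul, norm_inv, Complex.norm_real, norm_norm,
      inv_mul_cancel₀ h0.ne']
  · simp only [map_smul, map_smulₛₗ, LinearMap.smul_apply, smul_eq_mul, map_inv₀,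
      Complex.conj_ofReal]
    push_cast
    ring

theorem exists_mem_numRange (Ω : SForm D) {ξ : D} (hξ : ξ ≠ 0) :
    ∃ z ∈ numRange Ω, Ω ξ ξ = ((‖(ξ : H)‖ ^ 2 : ℝ) : ℂ) * z := by
  have h0 : 0 < ‖(ξ : H)‖ := by simpa using hξ
  refine ⟨_, mem_numRange_of_ne_zero Ω hξ, ?_⟩
  rw [mul_inv_cancel_left₀]
  exact_mod_cast (by positivity : ‖(ξ : H)‖ ^ 2 ≠ 0)

/-- The diagonal at `ξ + η` controls the imaginary part of `Ω ξ η`, the one at `ξ + i η` the real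
part. -/
theorem isSymmetric_of_diag {Ω : SForm D} (h : ∀ ξ, (Ω ξ ξ).im = 0) : IsSymmetric Ω := by
  intro ξ η
  have h1 := h (ξ + η)
  have h2 := h (ξ + Complex.I • η)
  simp only [map_add, map_smul, LinearMap.add_apply, LinearMap.smul_apply, map_smulₛₗ,
    smul_eq_mul, Complex.conj_I, Complex.add_im, Complex.mul_im, Complex.mul_re, Complex.neg_re,
    Complex.neg_im, Complex.I_re, Complex.I_im, Complex.add_re, h ξ, h η] at h1 h2
  apply Complex.ext
  · rw [Complex.conj_re]; linarith
  · rw [Complex.conj_im]; linarith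

theorem IsSymmetric.diag {Ω : SForm D} (h : IsSymmetric Ω) (ξ : D) : (Ω ξ ξ).im = 0 :=
  Complex.conj_eq_iff_im.1 (h ξ ξ).symm

theorem isSymmetric_iff_numRange {Ω : SForm D} :
    IsSymmetric Ω ↔ ∀ z ∈ numRange Ω, z.im = 0 := by
  constructor
  · rintro h z ⟨ξ, -, rfl⟩
    exact h.diag ξ
  · intro h
    refine isSymmetric_of_diag fun ξ => ?_
    rcases eq_or_ne ξ 0 with rfl | hξ
    · simp
    · obtain ⟨z, hz, h1⟩ := exists_mem_numRange Ω hξ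
      rw [h1, Complex.im_ofReal_mul, h z hz, mul_zero]

theorem IsSymmetric.add {Ω Φ : SForm D} (h : IsSymmetric Ω) (h' : IsSymmetric Φ) :
    IsSymmetric (Ω + Φ) := fun ξ η => by
  simp only [LinearMap.add_apply, map_add]
  rw [← h, ← h']

end Forms

/-! ### Coercive, accretive and sectorial forms; from Krein spaces to solvable forms -/

section Forms

variable {H : Type*} [NormedAddCommGroup H] [InnerProductSpace ℂ H] {D : Submodule ℂ H}

theorem restrict_smul_iota_apply (c : ℂ) (ξ η : D) :
    restrict D (c • iota) ξ η = c * inner ℂ (η : H) (ξ : H) := rfl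

theorem restrict_iota_apply (ξ η : D) : restrict D iota ξ η = inner ℂ (η : H) (ξ : H) := rfl

theorem inner_self_ofReal (x : H) : inner ℂ x x = ((‖x‖ ^ 2 : ℝ) : ℂ) := by
  rw [inner_self_eq_norm_sq_to_K]; simp

/-- The Lax–Milgram case: testing with the vector itself gives the lower bound and the nondegeneracy
at once. -/
theorem zero_mem_perturbations_of_coercive {Φ : SForm D} {N : NormOn D} (hi : N.IsInduced)
    (hc : CompleteSpace N.Space) (hb : IsBoundedOn Φ N) {c : ℝ} (hc0 : 0 < c)
    (h : ∀ ξ, c * N ξ ^ 2 ≤ ‖Φ ξ ξ‖) : 0 ∈ perturbations Φ N := by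
  refine zero_mem_perturbations_of_boundedBelow (C := c⁻¹) hi hc hb (fun ξ M hM hξ => ?_)
    fun η hη => ?_
  · have h1 := (h ξ).trans (hξ ξ)
    rw [← div_eq_inv_mul, le_div_iff₀ hc0]
    rcases (N.nonneg ξ).eq_or_lt with h0 | h0
    · rw [← h0]; simpa using hM
    · refine le_of_mul_le_mul_right ?_ h0
      linarith
  · have h1 := h η
    rw [hη η, norm_zero] at h1
    refine N.definite η ?_
    have h2 := nonpos_of_mul_nonpos_right h1 hc0
    exact pow_eq_zero_iff two_ne_zero |>.1 (le_antisymm h2 (sq_nonneg _))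

/-! ### Accretive forms -/

theorem re_nonneg_iff_numRange {Ω : SForm D} :
    (∀ ξ, 0 ≤ (Ω ξ ξ).re) ↔ ∀ z ∈ numRange Ω, 0 ≤ z.re := by
  constructor
  · rintro h z ⟨ξ, -, rfl⟩
    exact h ξ
  · intro h ξ
    rcases eq_or_ne ξ 0 with rfl | hξ
    · simp
    · obtain ⟨z, hz, h1⟩ := exists_mem_numRange Ω hξ
      rw [h1, Complex.re_ofReal_mul]
      exact mul_nonneg (sq_nonneg _) (h z hz)

theorem isClosedAccretive_iff {Ω : SForm D} : IsClosedAccretive Ω ↔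
    ∃ N, IsSolvableInner Ω N ∧ (∀ z ∈ numRange Ω, 0 ≤ z.re) ∧ iota ∈ perturbations Ω N := by
  rw [IsClosedAccretive, isZeroClosed_add_restrict_iff, re_nonneg_iff_numRange]
  constructor
  · rintro ⟨h, N, h1, h2⟩; exact ⟨N, h1, h, h2⟩
  · rintro ⟨N, h1, h, h2⟩; exact ⟨h, N, h1, h2⟩

/-- The lower bound for `Ω - iι` passes to `Ω + ι` up to an error proportional to `‖ξ‖`. Accretivity
gives `‖ξ‖ ^ 2 ≤ Re (Ω + ι)(ξ, ξ) ≤ M * N ξ`, so this error is of order `√(M * N ξ)` and can be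
absorbed into the left side. -/
theorem iota_mem_perturbations_of_accretive {Ω : SForm D} {N : NormOn D}
    (hN : IsSolvableInner Ω N) (hre : ∀ ξ, 0 ≤ (Ω ξ ξ).re)
    (h : -Complex.I • iota ∈ perturbations Ω N) : iota ∈ perturbations Ω N := by
  have hE := hN.isEmbeddedHilbert
  obtain ⟨K, hK0, hK⟩ := hE.embeds.exists_pos
  rw [mem_perturbations_iff] at h ⊢
  obtain ⟨C, hC, hbl⟩ := exists_isBoundedBelow hE.complete
    (hN.2.1.bounded.add (isBoundedOn_restrict hE.embeds _)) h
  have hdiag : ∀ ξ : D, ‖(ξ : H)‖ ^ 2 ≤ ((Ω + restrict D iota) ξ ξ).re := fun ξ => by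
    rw [LinearMap.add_apply, LinearMap.add_apply, restrict_iota_apply, inner_self_ofReal,
      Complex.add_re, Complex.ofReal_re]
    linarith [hre ξ]
  refine zero_mem_perturbations_of_boundedBelow (C := 2 * C + 4 * C ^ 2 * K ^ 2) hE.induced
    hE.complete (hN.2.1.bounded.add (isBoundedOn_restrict hE.embeds _)) (fun ξ M hM hξ => ?_)
    fun η hη => ?_
  · have h1 : N ξ ≤ C * (M + 2 * ‖(ξ : H)‖ * K) := hbl ξ _ (by positivity) fun η => by
      have e : (Ω + restrict D (-Complex.I • iota)) ξ η = (Ω + restrict D iota) ξ η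
          - (1 + Complex.I) * inner ℂ (η : H) (ξ : H) := by
        simp only [LinearMap.add_apply, restrict_smul_iota_apply, restrict_iota_apply]
        ring
      have e1 : ‖(1 + Complex.I)‖ ≤ 2 := by
        refine (norm_add_le _ _).trans ?_
        rw [Complex.norm_I, norm_one]; norm_num
      calc _ ≤ ‖(Ω + restrict D iota) ξ η‖ + ‖(1 + Complex.I) * inner ℂ (η : H) (ξ : H)‖ := by
            rw [e]; exact norm_sub_le _ _
        _ ≤ M * N η + 2 * (K * N η * ‖(ξ : H)‖) := by
            rw [norm_mul]
            gcongr
            · exact hξ η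
            · exact (norm_inner_le_norm _ _).trans (by gcongr; exact hK η)
        _ = _ := by ring
    have h2 : ‖(ξ : H)‖ ^ 2 ≤ M * N ξ :=
      (hdiag ξ).trans ((Complex.re_le_norm _).trans (hξ ξ))
    have hn := N.nonneg ξ
    -- The inequality of arithmetic and geometric means, weighted so that only half of `N ξ` has to
    -- be absorbed; this produces the constant `2 * C + 4 * C ^ 2 * K ^ 2`.
    have h3 : (2 * C * K * ‖(ξ : H)‖) ^ 2 ≤ ((4 * C ^ 2 * K ^ 2 * M + N ξ) / 2) ^ 2 := by
      have : (2 * C * K * ‖(ξ : H)‖) ^ 2 ≤ 4 * C ^ 2 * K ^ 2 * (M * N ξ) := by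
        calc _ = 4 * C ^ 2 * K ^ 2 * ‖(ξ : H)‖ ^ 2 := by ring
          _ ≤ _ := by gcongr
      nlinarith [sq_nonneg (4 * C ^ 2 * K ^ 2 * M - N ξ)]
    have h4 := abs_le_of_sq_le_sq' h3 (by positivity) |>.2
    nlinarith
  · have := hdiag η
    rw [hη η, Complex.zero_re] at this
    simpa using le_antisymm this (sq_nonneg _)

/-! ### Sectorial forms -/

/-- Off the vertex this is monotonicity of the tangent. At the vertex both sides vanish, in
accordance with the convention `arg 0 = 0`. -/
theorem re_sub_nonneg_and_im_le_of_mem_sector {γ θ : ℝ} (hθ : θ < Real.pi / 2) {z : ℂ}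
    (hz : z ∈ sector γ θ) : 0 ≤ z.re - γ ∧ |z.im| ≤ Real.tan θ * (z.re - γ) := by
  have hz' : |(z - γ).arg| ≤ θ := hz
  have hre : (z - γ).re = z.re - γ := by simp
  have him : (z - γ).im = z.im := by simp
  rcases Complex.abs_arg_lt_pi_div_two_iff.1 (hz'.trans_lt hθ) with h | h
  · rw [hre] at h
    refine ⟨h.le, ?_⟩
    have h1 := Complex.tan_arg (z - γ)
    rw [hre, him] at h1
    have h2 : |Real.tan (z - γ).arg| ≤ Real.tan θ := by
      have ha := abs_le.1 hz'
      have hp := Real.pi_pos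
      have h0 : 0 ≤ θ := (abs_nonneg _).trans hz'
      rw [abs_le, ← Real.tan_neg]
      exact ⟨Real.strictMonoOn_tan.monotoneOn ⟨by linarith, by linarith⟩
        ⟨by linarith, by linarith⟩ ha.1, Real.strictMonoOn_tan.monotoneOn
        ⟨by linarith, by linarith⟩ ⟨by linarith, by linarith⟩ ha.2⟩
    rwa [h1, abs_div, abs_of_pos h, div_le_iff₀ h] at h2
  · have h1 := congrArg Complex.re h
    have h2 := congrArg Complex.im h
    rw [hre, Complex.zero_re] at h1
    rw [him, Complex.zero_im] at h2
    rw [h1, h2]; simp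

/-- `Ω` satisfies the estimates of a form with vertex `γ` and slope `m`. -/
def IsSectorialWith (Ω : SForm D) (γ m : ℝ) : Prop :=
  ∀ ξ : D, 0 ≤ (Ω ξ ξ).re - γ * ‖(ξ : H)‖ ^ 2 ∧
    |(Ω ξ ξ).im| ≤ m * ((Ω ξ ξ).re - γ * ‖(ξ : H)‖ ^ 2)

theorem isSectorialWith_of_numRange_subset {Ω : SForm D} {γ θ : ℝ} (hθ : θ < Real.pi / 2)
    (h : numRange Ω ⊆ sector γ θ) : IsSectorialWith Ω γ (Real.tan θ) := by
  intro ξ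
  rcases eq_or_ne ξ 0 with rfl | hξ
  · simp
  · obtain ⟨z, hz, h1⟩ := exists_mem_numRange Ω hξ
    obtain ⟨h2, h3⟩ := re_sub_nonneg_and_im_le_of_mem_sector hθ (h hz)
    have e : ‖(ξ : H)‖ ^ 2 * z.re - γ * ‖(ξ : H)‖ ^ 2 = ‖(ξ : H)‖ ^ 2 * (z.re - γ) := by ring
    rw [h1, Complex.re_ofReal_mul, Complex.im_ofReal_mul, e]
    refine ⟨by positivity, ?_⟩
    rw [abs_mul, abs_of_nonneg (sq_nonneg ‖(ξ : H)‖)]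
    calc _ ≤ ‖(ξ : H)‖ ^ 2 * (Real.tan θ * (z.re - γ)) := by gcongr
      _ = _ := by ring

/-- The real part of a form. -/
noncomputable def realPart (Ω : SForm D) : SForm D :=
  LinearMap.mk₂'ₛₗ (RingHom.id ℂ) (starRingEnd ℂ) (fun x y : D => (Ω x y + conj (Ω y x)) / 2)
    (fun x y z => by simp only [map_add, LinearMap.add_apply]; ring)
    (fun c x y => by
      simp only [map_smul, LinearMap.smul_apply, map_smulₛₗ, smul_eq_mul, map_mul,
        Complex.conj_conj, RingHom.id_apply]
      ring)
    (fun x y z => by simp only [map_add, LinearMap.add_apply]; ring)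
    (fun c x y => by
      simp only [map_smul, LinearMap.smul_apply, map_smulₛₗ, smul_eq_mul, map_mul]
      ring)

theorem realPart_apply (Ω : SForm D) (x y : D) :
    realPart Ω x y = (Ω x y + conj (Ω y x)) / 2 := rfl

/-- The norm `(Re Ω(ξ, ξ) - γ ‖ξ‖² + ‖ξ‖²)^(1/2)`. -/
theorem exists_sectorial_norm {Ω : SForm D} {γ m : ℝ} (h : IsSectorialWith Ω γ m) :
    ∃ N : NormOn D, N.IsInduced ∧
      ∀ ξ : D, N ξ ^ 2 = (Ω ξ ξ).re - γ * ‖(ξ : H)‖ ^ 2 + ‖(ξ : H)‖ ^ 2 := by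
  -- Subtracting `γ ι` leaves a nonnegative real part; one further copy of `ι` makes it definite.
  let s : SForm D := realPart Ω + restrict D (((1 - γ : ℝ) : ℂ) • iota)
  have hs : ∀ x y, s y x = conj (s x y) := fun x y => by
    simp only [s, LinearMap.add_apply, realPart_apply, restrict_smul_iota_apply, map_add, map_mul,
      map_div₀, Complex.conj_conj, Complex.conj_ofReal, inner_conj_symm, Complex.conj_ofNat]
    ring
  have hre : ∀ ξ : D, (s ξ ξ).re = (Ω ξ ξ).re - γ * ‖(ξ : H)‖ ^ 2 + ‖(ξ : H)‖ ^ 2 := fun ξ => by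
    simp only [s, LinearMap.add_apply, realPart_apply, restrict_smul_iota_apply,
      inner_self_ofReal, Complex.add_conj, Complex.add_re, Complex.re_ofReal_mul,
      Complex.ofReal_re]
    rw [← Complex.ofReal_ofNat, ← Complex.ofReal_div, Complex.ofReal_re]
    ring
  have hpos : ∀ x, x ≠ 0 → 0 < (s x x).re := fun x hx => by
    have h0 : 0 < ‖(x : H)‖ := by simpa using hx
    rw [hre]
    have := (h x).1
    positivity
  exact ⟨NormOn.ofForm s hs hpos, NormOn.ofForm_isInduced s hs hpos, fun ξ => by
    rw [NormOn.ofForm_sq, hre]⟩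

theorem norm_le_of_sectorial_norm {Ω : SForm D} {γ m : ℝ} (h : IsSectorialWith Ω γ m)
    {N : NormOn D}
    (hN : ∀ ξ : D, N ξ ^ 2 = (Ω ξ ξ).re - γ * ‖(ξ : H)‖ ^ 2 + ‖(ξ : H)‖ ^ 2) (ξ : D) :
    ‖(ξ : H)‖ ≤ N ξ := by
  refine abs_le_of_sq_le_sq' ?_ (N.nonneg ξ) |>.2
  rw [hN]
  linarith [(h ξ).1]

theorem isBoundedOn_sectorial_norm {Ω : SForm D} {γ m : ℝ} (hm : 0 ≤ m)
    (h : IsSectorialWith Ω γ m) {N : NormOn D}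
    (hN : ∀ ξ : D, N ξ ^ 2 = (Ω ξ ξ).re - γ * ‖(ξ : H)‖ ^ 2 + ‖(ξ : H)‖ ^ 2) :
    IsBoundedOn Ω N := by
  refine isBoundedOn_of_diag (b := 1 + m + |γ|) (by positivity) fun ξ => ?_
  obtain ⟨h1, h2⟩ := h ξ
  have h3 : |(Ω ξ ξ).re| ≤ ((Ω ξ ξ).re - γ * ‖(ξ : H)‖ ^ 2) + |γ| * ‖(ξ : H)‖ ^ 2 := by
    have := abs_add_le ((Ω ξ ξ).re - γ * ‖(ξ : H)‖ ^ 2) (γ * ‖(ξ : H)‖ ^ 2)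
    rwa [sub_add_cancel, abs_of_nonneg h1, abs_mul, abs_of_nonneg (sq_nonneg ‖(ξ : H)‖)] at this
  have h4 : 0 ≤ ‖(ξ : H)‖ ^ 2 := sq_nonneg _
  have h5 := abs_nonneg γ
  rw [hN]
  refine (Complex.norm_le_abs_re_add_abs_im _).trans ?_
  nlinarith [mul_nonneg hm h4, mul_nonneg h5 h1]

theorem exists_embedding {N : NormOn D} (h : EmbedsContinuously N) :
    ∃ j : N.Space →L[ℂ] H, ∀ x, j x = (N.out x : D) := by
  obtain ⟨C, hC⟩ := h
  exact ⟨LinearMap.mkContinuous (D.subtype ∘ₗ N.ofₗ.symm.toLinearMap) C hC, fun _ => rfl⟩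

/-- For the norm built from the real part, Kato's closedness is exactly what completeness needs: a
Cauchy sequence converges in `H`, the limit lies in `D`, and convergence of `Ω[u n - y]` and in `H`
together give convergence in norm. -/
theorem IsKatoForm.exists_isSolvableInner [CompleteSpace H] {Ω : SForm D} (h : IsKatoForm Ω) :
    ∃ N, IsSolvableInner Ω N ∧ ∃ γ θ : ℝ, 0 ≤ θ ∧ θ < Real.pi / 2 ∧ numRange Ω ⊆ sector γ θ ∧
      ∃ l : ℂ, l ∉ sector γ θ ∧ -l • iota ∈ perturbations Ω N := by
  obtain ⟨⟨γ, θ, hθ0, hθ, hsec⟩, hcl⟩ := h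
  have hS := isSectorialWith_of_numRange_subset hθ hsec
  have hm : 0 ≤ Real.tan θ := Real.tan_nonneg_of_nonneg_of_le_pi_div_two hθ0 hθ.le
  obtain ⟨N, hi, hN⟩ := exists_sectorial_norm hS
  have hb := isBoundedOn_sectorial_norm hm hS hN
  have hemb : EmbedsContinuously N :=
    ⟨1, fun ξ => by rw [one_mul]; exact norm_le_of_sectorial_norm hS hN ξ⟩
  obtain ⟨j, hj⟩ := exists_embedding hemb
  have hcomp : CompleteSpace N.Space := by
    refine Metric.complete_of_cauchySeq_tendsto fun u hu => ?_
    have hju : CauchySeq (j ∘ u) := hu.map j.uniformContinuous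
    obtain ⟨x, hx⟩ := cauchySeq_tendsto_of_complete hju
    have hx' : Tendsto (fun n => ((N.out (u n) : D) : H)) atTop (𝓝 x) :=
      hx.congr fun n => hj (u n)
    obtain ⟨β, -, hβ⟩ := hb
    have hd := cauchySeq_iff_tendsto_dist_atTop_0.1 hu
    obtain ⟨y, rfl, hy⟩ := hcl (fun n => N.out (u n)) x hx' (by
      refine squeeze_zero_norm (fun p => ?_)
        (a := fun p : ℕ × ℕ => β * dist (u p.1) (u p.2) * dist (u p.1) (u p.2)) ?_
      · rw [dist_eq_norm]
        exact hβ (N.out (u p.1) - N.out (u p.2)) (N.out (u p.1) - N.out (u p.2))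
      · simpa using (hd.const_mul β).mul hd)
    refine ⟨N.of y, tendsto_iff_norm_sub_tendsto_zero.2 ?_⟩
    have h1 : Tendsto (fun n => ‖((N.out (u n) - y : D) : H)‖ ^ 2) atTop (𝓝 0) := by
      have := (tendsto_iff_norm_sub_tendsto_zero.1 hx').pow 2
      simpa using this
    have h2 : Tendsto (fun n => N (N.out (u n) - y) ^ 2) atTop (𝓝 0) := by
      have := (((Complex.continuous_re.tendsto _).comp hy).sub (h1.const_mul γ)).add h1
      simp only [Complex.zero_re, mul_zero, sub_zero, add_zero] at this
      exact this.congr fun n => (hN _).symm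
    have h3 := (Real.continuous_sqrt.tendsto _).comp h2
    rw [Real.sqrt_zero] at h3
    exact h3.congr fun n => Real.sqrt_sq (N.nonneg _)
  have hE : IsEmbeddedHilbert N := ⟨hi, hcomp, hemb⟩
  -- With the shift `γ - 1`, just left of the vertex, the real part of the shifted form on the
  -- diagonal equals `N ξ ^ 2`.
  have hP : -((γ - 1 : ℝ) : ℂ) • iota ∈ perturbations Ω N := by
    rw [mem_perturbations_iff]
    refine zero_mem_perturbations_of_coercive (c := 1) hi hcomp
      (hb.add (isBoundedOn_restrict hemb _)) one_pos fun ξ => ?_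
    refine le_trans (le_of_eq ?_) (Complex.re_le_norm _)
    rw [LinearMap.add_apply, LinearMap.add_apply, restrict_smul_iota_apply, inner_self_ofReal,
      ← Complex.ofReal_neg, ← Complex.ofReal_mul, Complex.add_re, Complex.ofReal_re, hN]
    ring
  refine ⟨N, hE.isSolvableInner hb hP, γ, θ, hθ0, hθ, hsec, _, ?_, hP⟩
  intro hl
  have := (re_sub_nonneg_and_im_le_of_mem_sector hθ hl).1
  rw [Complex.ofReal_re] at this
  linarith

/-- The given norm `N` is equivalent to the norm `N'` of the real part. Boundedness of `Ω` and of
the embedding dominates `N'` by `N`. In the other direction, `Ω + U` is bounded for `N'` and bounded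
below for `N`. A sequence as in Kato's definition is Cauchy for `N'`, hence for the complete norm
`N`. -/
theorem IsSectorialWith.isKatoClosed {Ω : SForm D} {γ m : ℝ} (hm : 0 ≤ m)
    (hS : IsSectorialWith Ω γ m) {N : NormOn D} (h : IsSolvable Ω N) : IsKatoClosed Ω := by
  obtain ⟨⟨⟨hcomp, -⟩, hemb, hb⟩, U, hU⟩ := h
  obtain ⟨N', -, hN'⟩ := exists_sectorial_norm hS
  have hle := norm_le_of_sectorial_norm hS hN'
  have hb' := (isBoundedOn_sectorial_norm hm hS hN').add
    (isBoundedOn_restrict ⟨1, fun ξ => by rw [one_mul]; exact hle ξ⟩ U)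
  obtain ⟨C, hC, hbl⟩ := exists_isBoundedBelow hcomp (hb.add (isBoundedOn_restrict hemb U))
    (mem_perturbations_iff.1 hU)
  obtain ⟨β, hβ0, hβ⟩ := hb
  obtain ⟨β', hβ'0, hβ'⟩ := hb'
  obtain ⟨K, hK0, hK⟩ := hemb.exists_pos
  have hN'N : ∃ A, 0 ≤ A ∧ ∀ ξ, N' ξ ≤ A * N ξ := by
    refine ⟨√(β + |γ| * K ^ 2 + K ^ 2), Real.sqrt_nonneg _, fun ξ => ?_⟩
    refine abs_le_of_sq_le_sq' ?_ (mul_nonneg (Real.sqrt_nonneg _) (N.nonneg ξ)) |>.2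
    rw [mul_pow, Real.sq_sqrt (by positivity), hN']
    have h1 := (Complex.re_le_norm _).trans (hβ ξ ξ)
    have h2 : ‖(ξ : H)‖ ^ 2 ≤ K ^ 2 * N ξ ^ 2 := by
      rw [← mul_pow]; gcongr; exact hK ξ
    have h3 : -γ * ‖(ξ : H)‖ ^ 2 ≤ |γ| * (K ^ 2 * N ξ ^ 2) :=
      mul_le_mul (neg_le_abs γ) h2 (sq_nonneg _) (abs_nonneg _)
    nlinarith
  obtain ⟨A, hA0, hA⟩ := hN'N
  have hNN' : ∀ ξ, N ξ ≤ C * (β' * A * N' ξ) := fun ξ =>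
    hbl ξ _ (mul_nonneg (by positivity) (N'.nonneg ξ)) fun η => by
      calc _ ≤ β' * N' ξ * N' η := hβ' ξ η
        _ ≤ β' * N' ξ * (A * N η) :=
          mul_le_mul_of_nonneg_left (hA η) (mul_nonneg hβ'0 (N'.nonneg ξ))
        _ = _ := by ring
  intro u x hux huΩ
  obtain ⟨j, hj⟩ := exists_embedding hemb
  have hd : Tendsto (fun p : ℕ × ℕ => N' (u p.1 - u p.2)) atTop (𝓝 0) := by
    have h1 : Tendsto (fun p : ℕ × ℕ => ‖((u p.1 - u p.2 : D) : H)‖ ^ 2) atTop (𝓝 0) := by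
      have h0 := cauchySeq_iff_tendsto_dist_atTop_0.1 hux.cauchySeq
      simp only [dist_eq_norm] at h0
      simpa using h0.pow 2
    have h2 : Tendsto (fun p : ℕ × ℕ => N' (u p.1 - u p.2) ^ 2) atTop (𝓝 0) := by
      have := (((Complex.continuous_re.tendsto _).comp huΩ).sub (h1.const_mul γ)).add h1
      simp only [Complex.zero_re, mul_zero, sub_zero, add_zero] at this
      exact this.congr fun n => (hN' _).symm
    have h3 := (Real.continuous_sqrt.tendsto _).comp h2
    rw [Real.sqrt_zero] at h3
    exact h3.congr fun n => Real.sqrt_sq (N'.nonneg _)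
  have hcau : CauchySeq (fun n => N.of (u n)) := by
    rw [cauchySeq_iff_tendsto_dist_atTop_0]
    refine squeeze_zero (fun _ => dist_nonneg) (fun p => ?_)
      (by simpa using (hd.const_mul (β' * A)).const_mul C)
    rw [dist_eq_norm]
    exact hNN' (u p.1 - u p.2)
  obtain ⟨y, hy⟩ := cauchySeq_tendsto_of_complete hcau
  have hyx : ((N.out y : D) : H) = x := by
    refine tendsto_nhds_unique ?_ hux
    rw [← hj]
    exact ((j.continuous.tendsto y).comp hy).congr fun n => hj _
  refine ⟨N.out y, hyx, ?_⟩
  have hn := tendsto_iff_norm_sub_tendsto_zero.1 hy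
  refine squeeze_zero_norm (fun n => hβ (u n - N.out y) (u n - N.out y)) ?_
  have := (hn.const_mul β).mul hn
  rw [mul_zero] at this
  exact this

theorem isKatoForm_of_isSolvable {Ω : SForm D} {N : NormOn D} (hN : IsSolvable Ω N) {γ θ : ℝ}
    (hθ0 : 0 ≤ θ) (hθ : θ < Real.pi / 2) (h : numRange Ω ⊆ sector γ θ) : IsKatoForm Ω :=
  ⟨⟨γ, θ, hθ0, hθ, h⟩, (isSectorialWith_of_numRange_subset hθ h).isKatoClosed
    (Real.tan_nonneg_of_nonneg_of_le_pi_div_two hθ0 hθ.le) hN⟩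

theorem isKatoForm_iff [CompleteSpace H] {Ω : SForm D} : IsKatoForm Ω ↔
    ∃ N, IsSolvableInner Ω N ∧ ∃ γ θ : ℝ, 0 ≤ θ ∧ θ < Real.pi / 2 ∧ numRange Ω ⊆ sector γ θ ∧
      ∃ l : ℂ, l ∉ sector γ θ ∧ -l • iota ∈ perturbations Ω N :=
  ⟨fun h => h.exists_isSolvableInner, fun ⟨_, hN, _, _, hθ0, hθ, h, _⟩ =>
    isKatoForm_of_isSolvable hN.2 hθ0 hθ h⟩

theorem isSymmetric_and_isKatoForm_iff [CompleteSpace H] {Ω : SForm D} :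
    (IsSymmetric Ω ∧ IsKatoForm Ω) ↔
      ∃ N, IsSolvable Ω N ∧ ∃ w : ℝ, ∀ z ∈ numRange Ω, z.im = 0 ∧ w ≤ z.re := by
  constructor
  · rintro ⟨hs, hK⟩
    obtain ⟨N, hN, γ, θ, -, hθ, h, -⟩ := hK.exists_isSolvableInner
    exact ⟨N, hN.2, γ, fun z hz => ⟨isSymmetric_iff_numRange.1 hs z hz,
      sub_nonneg.1 (re_sub_nonneg_and_im_le_of_mem_sector hθ (h hz)).1⟩⟩
  · rintro ⟨N, hN, w, h⟩
    refine ⟨isSymmetric_iff_numRange.2 fun z hz => (h z hz).1,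
      isKatoForm_of_isSolvable (γ := w) hN le_rfl (by positivity) fun z hz => ?_⟩
    obtain ⟨h1, h2⟩ := h z hz
    have : (z - w).arg = 0 := Complex.arg_eq_zero_iff.2 ⟨by simpa using h2, by simpa using h1⟩
    simp [sector, this]

/-! ### Coercive forms -/

/-- The Toeplitz–Hausdorff theorem. -/
theorem convex_numRange (Ω : SForm D) : Convex ℝ (numRange Ω) := by
  rw [convex_iff_segment_subset]
  rintro a ⟨ξ, hξ, ha⟩ b ⟨η, hη, hb⟩
  rcases eq_or_ne a b with rfl | hab
  · rw [segment_same, Set.singleton_subset_iff]; exact ⟨ξ, hξ, ha⟩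
  have hba : b - a ≠ 0 := sub_ne_zero.2 hab.symm
  -- An affine change of the form moves the two end points to 0 and 1.
  let Ψ : SForm D := (b - a)⁻¹ • (Ω + restrict D (-a • iota))
  have hΨ : ∀ x, Ω x x = a * ((‖(x : H)‖ ^ 2 : ℝ) : ℂ) + (b - a) * Ψ x x := fun x => by
    simp only [Ψ, LinearMap.smul_apply, LinearMap.add_apply, restrict_smul_iota_apply,
      inner_self_ofReal, smul_eq_mul]
    rw [mul_inv_cancel_left₀ hba]; ring
  have hΨξ : Ψ ξ ξ = 0 := by
    have := hΨ ξ
    rw [ha, hξ] at this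
    simpa [hba] using this
  -- This phase makes the cross term `Ψ ξ (c • η) + Ψ (c • η) ξ` real, so that `Ψ` is real along the
  -- segment from `ξ` to `c • η`.
  obtain ⟨c, hc, hcw⟩ := RCLike.exists_norm_eq_mul_self (Ψ η ξ - conj (Ψ ξ η))
  have hcc : c * conj c = 1 := by rw [Complex.mul_conj']; simp [hc]
  have hΨη : Ψ (c • η) (c • η) = 1 := by
    have h1 := hΨ η
    rw [hb, hη] at h1
    have h2 : Ψ η η = 1 := by
      apply mul_left_cancel₀ hba
      simp only [one_pow, Complex.ofReal_one, mul_one] at h1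
      linear_combination -h1
    simp only [map_smul, LinearMap.smul_apply, map_smulₛₗ, smul_eq_mul, h2, mul_one]
    linear_combination hcc
  obtain ⟨r, hr⟩ : ∃ r : ℝ, Ψ ξ (c • η) + Ψ (c • η) ξ = r := by
    refine Complex.conj_eq_iff_real.1 ?_
    have h1 := congrArg conj hcw
    rw [RCLike.conj_ofReal, hcw] at h1
    simp only [map_mul, map_sub, Complex.conj_conj] at h1
    simp only [map_smul, LinearMap.smul_apply, map_smulₛₗ, smul_eq_mul, map_add, map_mul,
      Complex.conj_conj]
    linear_combination -h1
  let x : ℝ → D := fun t => ((1 - t : ℝ) : ℂ) • ξ + (t : ℂ) • (c • η)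
  have hx : ∀ t, Ψ (x t) (x t) = ((t ^ 2 + t * (1 - t) * r : ℝ) : ℂ) := fun t => by
    have : Ψ (x t) (x t) = (1 - t) ^ 2 * Ψ ξ ξ + t * (1 - t) * (Ψ ξ (c • η) + Ψ (c • η) ξ)
        + t ^ 2 * Ψ (c • η) (c • η) := by
      simp only [x, map_add, LinearMap.add_apply, LinearMap.map_smul Ψ,
        LinearMap.smul_apply, LinearMap.map_smulₛₗ, smul_eq_mul, Complex.conj_ofReal]
      push_cast
      ring
    rw [this, hΨξ, hΨη, hr]; push_cast; ring
  -- The diagonal of `Ψ` vanishes at `ξ` and is 1 at `c • η`, so a relation between them forces `t =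
  -- 0` and then `ξ = 0`.
  have hx0 : ∀ t, x t ≠ 0 := fun t ht => by
    have e : ((1 - t : ℝ) : ℂ) • ξ = -(t : ℂ) • (c • η) := by
      rw [neg_smul]; exact eq_neg_of_add_eq_zero_left ht
    have h1 : Ψ (((1 - t : ℝ) : ℂ) • ξ) (((1 - t : ℝ) : ℂ) • ξ) = 0 := by
      rw [LinearMap.map_smul Ψ, LinearMap.smul_apply, LinearMap.map_smulₛₗ, hΨξ]; simp
    rw [e, LinearMap.map_smul Ψ, LinearMap.smul_apply, LinearMap.map_smulₛₗ, hΨη] at h1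
    have ht0 : t = 0 := by simpa using h1
    rw [ht0] at ht
    have : ξ = 0 := by simpa [x] using ht
    rw [this] at hξ
    simp at hξ
  have hnx : ∀ t, 0 < ‖(x t : H)‖ ^ 2 := fun t => by
    have : 0 < ‖(x t : H)‖ := by simpa using hx0 t
    positivity
  have hxc : Continuous x := by fun_prop
  let g : ℝ → ℝ := fun t => (t ^ 2 + t * (1 - t) * r) / ‖(x t : H)‖ ^ 2
  have hg : Continuous g := Continuous.div (by fun_prop) (by fun_prop) fun t => (hnx t).ne'
  have hg0 : g 0 = 0 := by simp [g]
  have hg1 : g 1 = 1 := by simp [g, x, norm_smul, hc, hη]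
  rw [segment_eq_image]
  rintro _ ⟨s, hs, rfl⟩
  obtain ⟨t, -, hgt⟩ := intermediate_value_Icc zero_le_one hg.continuousOn
    (show s ∈ Set.Icc (g 0) (g 1) by rwa [hg0, hg1])
  convert mem_numRange_of_ne_zero Ω (hx0 t) using 1
  have hne : ((‖(x t : H)‖ ^ 2 : ℝ) : ℂ) ≠ 0 := by exact_mod_cast (hnx t).ne'
  rw [hΨ, hx, ← hgt]
  simp only [g, Complex.real_smul, Complex.ofReal_sub, Complex.ofReal_div, Complex.ofReal_one]
  field_simp
  ring

/-- A convex set of complex numbers with positive distance to `0` lies in a closed half-plane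
that does not contain `0`. -/
theorem exists_halfPlane {S : Set ℂ} (hS : Convex ℝ S) {d : ℝ} (hd : 0 < d)
    (h : ∀ z ∈ S, d ≤ ‖z‖) :
    ∃ (u : ℂ) (c : ℝ), ‖u‖ = 1 ∧ 0 < c ∧ ∀ z ∈ S, c ≤ (u * z).re := by
  rcases S.eq_empty_or_nonempty with rfl | ⟨z₀, hz₀⟩
  · exact ⟨1, 1, by simp, one_pos, by simp⟩
  -- Hahn–Banach separates `S` from the open ball of radius `d`; the centre of the ball yields `0 <
  -- c`.
  obtain ⟨f, c, hf, hc⟩ := geometric_hahn_banach_open (convex_ball (0 : ℂ) d) Metric.isOpen_ball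
    hS (Set.disjoint_left.2 fun z hz hz' => by
      rw [mem_ball_zero_iff] at hz
      exact absurd (h z hz') (not_le.2 hz))
  have hc0 : 0 < c := by simpa using hf 0 (Metric.mem_ball_self hd)
  let w : ℂ := ⟨f 1, -f Complex.I⟩
  have hw : ∀ z, f z = (w * z).re := fun z => by
    have e : z = z.re • (1 : ℂ) + z.im • Complex.I := by
      apply Complex.ext <;> simp
    conv_lhs => rw [e, map_add, map_smul, map_smul]
    simp [w, Complex.mul_re]
    ring
  have hw0 : 0 < ‖w‖ := by
    rw [norm_pos_iff]
    intro h0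
    have := hc z₀ hz₀
    rw [hw, h0, zero_mul, Complex.zero_re] at this
    linarith
  refine ⟨((‖w‖⁻¹ : ℝ) : ℂ) * w, ‖w‖⁻¹ * c, ?_, by positivity, fun z hz => ?_⟩
  · rw [norm_mul, Complex.norm_real, Real.norm_of_nonneg (by positivity),
      inv_mul_cancel₀ hw0.ne']
  · rw [mul_assoc, Complex.re_ofReal_mul, ← hw]
    have := hc z hz
    gcongr

/-- A unit vector of `H` has `N ξ ≥ K⁻¹`, so coercivity keeps the numerical range at distance at
least `c * K⁻¹ ^ 2` from 0; being convex, it can be separated from 0. -/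
theorem IsLionsForm.exists_isSolvableInner {Ω : SForm D} (h : IsLionsForm Ω) :
    ∃ N, IsSolvableInner Ω N ∧ (∃ (u : ℂ) (c : ℝ), ‖u‖ = 1 ∧ 0 < c ∧
      ∀ z ∈ numRange Ω, c ≤ (u * z).re) ∧ 0 ∈ perturbations Ω N := by
  obtain ⟨N, hN, hb, c, hc, hco⟩ := h
  have h0 := zero_mem_perturbations_of_coercive hN.induced hN.complete hb hc hco
  refine ⟨N, hN.isSolvableInner hb h0, ?_, h0⟩
  obtain ⟨K, hK0, hK⟩ := hN.embeds.exists_pos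
  refine exists_halfPlane (convex_numRange Ω) (d := c * (K⁻¹) ^ 2) (by positivity) ?_
  rintro _ ⟨ξ, hξ, rfl⟩
  refine le_trans ?_ (hco ξ)
  have := hK ξ
  rw [hξ] at this
  gcongr
  rwa [inv_le_iff_one_le_mul₀ hK0, mul_comm]

/-! ### Krein spaces -/

/-- The fundamental symmetry `π - κ` turns `Φ` into the inner product `Φ(x, (π - κ) y)` of the norm
`N`. It is isometric, so testing with `(π - κ) ξ` bounds `Φ(ξ, ·)` below with constant 1. -/
theorem IsEmbeddedKrein.exists_isEmbeddedHilbert {Φ : SForm D} (h : IsEmbeddedKrein Φ) :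
    ∃ N, IsEmbeddedHilbert N ∧ IsBoundedOn Φ N ∧ 0 ∈ perturbations Φ N := by
  obtain ⟨hΦs, P, M, N, hPM, hort, hP, hM, hN, hPc, hMc, hemb⟩ := h
  have hort' : ∀ p ∈ P, ∀ m ∈ M, Φ m p = 0 := fun p hp m hm => by
    rw [hΦs m p, hort p hp m hm, map_zero]
  let π : D →ₗ[ℂ] D := P.subtype ∘ₗ P.projectionOnto M hPM
  let κ : D →ₗ[ℂ] D := M.subtype ∘ₗ M.projectionOnto P hPM.symm
  have hπ : ∀ x, π x ∈ P := fun x => (P.projectionOnto M hPM x).2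
  have hκ : ∀ x, κ x ∈ M := fun x => (M.projectionOnto P hPM.symm x).2
  have hsum : ∀ x, π x + κ x = x := fun x =>
    Submodule.projection_add_projection_eq_self hPM x
  have hNx : ∀ x, N x ^ 2 = (Φ (π x) (π x)).re - (Φ (κ x) (κ x)).re := fun x => by
    have := hN (π x) (hπ x) (κ x) (hκ x)
    rwa [hsum] at this
  have hP0 : ∀ p ∈ P, 0 ≤ (Φ p p).re := fun p hp => by
    rcases eq_or_ne p 0 with rfl | h
    · simp
    · exact (hP p hp h).le
  have hM0 : ∀ m ∈ M, (Φ m m).re ≤ 0 := fun m hm => by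
    rcases eq_or_ne m 0 with rfl | h
    · simp
    · exact (hM m hm h).le
  have hNP : ∀ p ∈ P, N p ^ 2 = (Φ p p).re := fun p hp => by
    simpa using hN p hp 0 M.zero_mem
  have hNM : ∀ m ∈ M, N m ^ 2 = -(Φ m m).re := fun m hm => by
    simpa using hN 0 P.zero_mem m hm
  have hle : ∀ x, N (π x) ≤ N x := fun x => abs_le_of_sq_le_sq' (by
    rw [hNP _ (hπ x), hNx]; linarith [hM0 _ (hκ x)]) (N.nonneg x) |>.2
  have hle' : ∀ x, N (κ x) ≤ N x := fun x => abs_le_of_sq_le_sq' (by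
    rw [hNM _ (hκ x), hNx]; linarith [hP0 _ (hπ x)]) (N.nonneg x) |>.2
  have hdiag : ∀ x, (Φ x (π x - κ x)).re = N x ^ 2 := fun x => by
    rw [hNx]
    conv_lhs => rw [← hsum x]
    rw [show π (π x + κ x) = π x by rw [hsum], show κ (π x + κ x) = κ x by rw [hsum]]
    rw [map_sub, map_add, LinearMap.add_apply, LinearMap.add_apply, hort _ (hπ x) _ (hκ x),
      hort' _ (hπ x) _ (hκ x)]
    simp
  have hi : N.IsInduced := by
    refine N.isInduced_of_inner (Φ.compl₂ (π - κ)) (fun x y => ?_) fun x => (hdiag x).symm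
    change Φ y (π x - κ x) = conj (Φ x (π y - κ y))
    rw [← hΦs]
    conv_lhs => rw [← hsum y]
    conv_rhs => rw [← hsum x]
    simp only [map_sub, map_add, LinearMap.add_apply, LinearMap.sub_apply,
      hort _ (hπ _) _ (hκ _), hort' _ (hπ _) _ (hκ _)]
    ring
  have hcomp : CompleteSpace N.Space := by
    refine Metric.complete_of_cauchySeq_tendsto fun u hu => ?_
    have hcau : ∀ f : D →ₗ[ℂ] D, (∀ x, N (f x) ≤ N x) →
        CauchySeq fun n => N.of (f (N.out (u n))) := fun f hf => by
      rw [cauchySeq_iff_tendsto_dist_atTop_0] at hu ⊢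
      refine squeeze_zero (fun _ => dist_nonneg) (fun p => ?_) hu
      rw [dist_eq_norm, dist_eq_norm]
      have := hf (N.out (u p.1) - N.out (u p.2))
      rw [map_sub] at this
      exact this
    obtain ⟨p, -, hp⟩ := cauchySeq_tendsto_of_isComplete hPc
      (fun n => ⟨_, hπ (N.out (u n)), rfl⟩) (hcau π hle)
    obtain ⟨m, -, hm⟩ := cauchySeq_tendsto_of_isComplete hMc
      (fun n => ⟨_, hκ (N.out (u n)), rfl⟩) (hcau κ hle')
    exact ⟨p + m, (hp.add hm).congr fun n => hsum (N.out (u n))⟩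
  have hE : IsEmbeddedHilbert N := ⟨hi, hcomp, hemb⟩
  have hNJ : ∀ x, N (π x - κ x) = N x := fun x => by
    have h1 := hN (π x) (hπ x) (-κ x) (M.neg_mem (hκ x))
    rw [← sub_eq_add_neg] at h1
    refine (sq_eq_sq₀ (N.nonneg _) (N.nonneg _)).1 ?_
    rw [h1, hNx]
    simp
  have hbΦ : IsBoundedOn Φ N := by
    refine isBoundedOn_of_diag (b := 1) zero_le_one fun ξ => ?_
    have e : Φ ξ ξ = ((Φ (π ξ) (π ξ)).re + (Φ (κ ξ) (κ ξ)).re : ℝ) := by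
      have h1 : ∀ x, ((Φ x x).re : ℂ) = Φ x x := fun x => Complex.conj_eq_iff_re.1 (hΦs x x).symm
      push_cast
      rw [h1, h1]
      conv_lhs => rw [← hsum ξ]
      simp only [map_add, LinearMap.add_apply, hort _ (hπ _) _ (hκ _), hort' _ (hπ _) _ (hκ _)]
      ring
    rw [e, Complex.norm_real, Real.norm_eq_abs, one_mul, hNx, abs_le]
    have := hP0 _ (hπ ξ)
    have := hM0 _ (hκ ξ)
    constructor <;> linarith
  have hbl : IsBoundedBelow Φ N 1 := fun ξ B hB hξ => by
    have h1 : N ξ ^ 2 ≤ B * N ξ := by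
      rw [← hdiag, ← hNJ ξ]
      exact (Complex.re_le_norm _).trans (hξ _)
    rcases (N.nonneg ξ).eq_or_lt with h0 | h0
    · rw [← h0]; linarith
    · nlinarith
  have h0 : 0 ∈ perturbations Φ N :=
    zero_mem_perturbations_of_boundedBelow hi hcomp hbΦ hbl fun η hη => by
      have := hbl η 0 le_rfl fun ξ => by rw [hΦs, hη]; simp
      rw [mul_zero] at this
      exact N.definite η (le_antisymm this (N.nonneg η))
  exact ⟨N, hE, hbΦ, h0⟩

theorem IsFHSForm.exists_isSolvableInner {Ω : SForm D} (h : IsFHSForm Ω) :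
    ∃ N, IsSolvableInner Ω N ∧ (∀ z ∈ numRange Ω, z.im = 0) ∧
      ∃ l : ℝ, -(l : ℂ) • iota ∈ perturbations Ω N := by
  obtain ⟨hsym, l, hK⟩ := h
  obtain ⟨N, hN, hU⟩ := isZeroClosed_add_restrict_iff.1
    (isZeroClosed_iff.2 hK.exists_isEmbeddedHilbert)
  exact ⟨N, hN, isSymmetric_iff_numRange.1 hsym, l, hU⟩

end Forms

/-! ### Norms pulled back along injective linear maps -/

section Norms

variable {V : Type*} [AddCommGroup V] [Module ℂ V]

/-- The norm `x ↦ ‖f x‖` defined by an injective linear map into a normed space. -/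
noncomputable def NormOn.comap {F : Type*} [NormedAddCommGroup F] [NormedSpace ℂ F]
    (f : V →ₗ[ℂ] F) (hf : Function.Injective f) : NormOn V :=
  { (normSeminorm ℂ F).comp f with
    definite := fun x hx => hf ((norm_eq_zero.1 hx : f x = 0).trans (map_zero f).symm) }

theorem NormOn.isometry_comap {F : Type*} [NormedAddCommGroup F] [NormedSpace ℂ F]
    (f : V →ₗ[ℂ] F) (hf : Function.Injective f) :
    Isometry fun x : (NormOn.comap f hf).Space => f ((NormOn.comap f hf).out x) :=
  AddMonoidHomClass.isometry_of_norm (f ∘ₗ (NormOn.comap f hf).ofₗ.symm.toLinearMap)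
    fun _ => rfl

theorem NormOn.completeSpace_comap {F : Type*} [NormedAddCommGroup F] [NormedSpace ℂ F]
    [CompleteSpace F] (f : V →ₗ[ℂ] F) (hf : Function.Injective f)
    (h : IsClosed (Set.range f)) : CompleteSpace (NormOn.comap f hf).Space :=
  (completeSpace_iff_isComplete_range (NormOn.isometry_comap f hf).isUniformInducing).2
    (IsClosed.isComplete h)

theorem NormOn.isInduced_comap {F : Type*} [NormedAddCommGroup F] [InnerProductSpace ℂ F]
    (f : V →ₗ[ℂ] F) (hf : Function.Injective f) : (NormOn.comap f hf).IsInduced := by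
  refine NormOn.isInduced_of_inner _ (LinearMap.mk₂'ₛₗ (RingHom.id ℂ) (starRingEnd ℂ)
    (fun x y => inner ℂ (f y) (f x)) (fun x y z => by rw [map_add, inner_add_right])
    (fun c x y => by rw [map_smul, inner_smul_right]; rfl)
    (fun x y z => by rw [map_add, inner_add_left])
    (fun c x y => by rw [map_smul, inner_smul_left]; rfl)) (fun x y => ?_) fun x => ?_
  · exact (inner_conj_symm _ _).symm
  · exact norm_sq_eq_re_inner (𝕜 := ℂ) (f x)

end Norms

/-! ### Polar decompositions and self-adjointness -/

section Operators

variable {E : Type*} [NormedAddCommGroup E] [InnerProductSpace ℂ E] [CompleteSpace E]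
variable {H : Type*} [NormedAddCommGroup H] [InnerProductSpace ℂ H] [CompleteSpace H]

/-- The polar decomposition `T = J |T|` of an invertible self-adjoint operator, with a square root
`B` of `|T|`. -/
theorem exists_polar_of_isSelfAdjoint {T : E →L[ℂ] E} (hT : IsSelfAdjoint T) (hu : IsUnit T) :
    ∃ J B C : E →L[ℂ] E, IsSelfAdjoint J ∧ IsSelfAdjoint B ∧ J * J = 1 ∧ C * B = 1 ∧ B * C = 1 ∧
      J * B = B * J ∧ T = B * B * J := by
  -- Invertibility keeps 0 out of the spectrum, so the sign `x / |x|` and `(√|x|)⁻¹` are continuous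
  -- there.
  have h0 : ∀ x ∈ spectrum ℝ T, x ≠ 0 := fun x hx h =>
    spectrum.zero_notMem ℝ hu (h ▸ hx)
  have hs0 : ∀ x ∈ spectrum ℝ T, √|x| ≠ 0 := fun x hx =>
    (Real.sqrt_pos.2 (abs_pos.2 (h0 x hx))).ne'
  have hj : ContinuousOn (fun x : ℝ => x / |x|) (spectrum ℝ T) :=
    continuousOn_id.div continuous_abs.continuousOn fun x hx => abs_ne_zero.2 (h0 x hx)
  have hb : ContinuousOn (fun x : ℝ => √|x|) (spectrum ℝ T) := by fun_prop
  have hc : ContinuousOn (fun x : ℝ => (√|x|)⁻¹) (spectrum ℝ T) := hb.inv₀ hs0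
  refine ⟨cfc (fun x : ℝ => x / |x|) T, cfc (fun x : ℝ => √|x|) T, cfc (fun x : ℝ => (√|x|)⁻¹) T,
    cfc_predicate _ _, cfc_predicate _ _, ?_, ?_, ?_, ?_, ?_⟩
  · rw [← cfc_mul _ _ T hj hj, ← cfc_const_one ℝ T]
    refine cfc_congr fun x hx => ?_
    have := abs_ne_zero.2 (h0 x hx)
    change x / |x| * (x / |x|) = 1
    rw [div_mul_div_comm, abs_mul_abs_self, div_self (mul_ne_zero (h0 x hx) (h0 x hx))]
  · rw [← cfc_mul _ _ T hc hb, ← cfc_const_one ℝ T]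
    exact cfc_congr fun x hx => inv_mul_cancel₀ (hs0 x hx)
  · rw [← cfc_mul _ _ T hb hc, ← cfc_const_one ℝ T]
    exact cfc_congr fun x hx => mul_inv_cancel₀ (hs0 x hx)
  · rw [← cfc_mul _ _ T hj hb, ← cfc_mul _ _ T hb hj]
    exact cfc_congr fun x hx => mul_comm _ _
  · rw [← cfc_mul _ _ T hb hb, ← cfc_mul (fun x : ℝ => √|x| * √|x|) _ T (hb.mul hb) hj]
    conv_lhs => rw [← cfc_id' ℝ T]
    refine cfc_congr fun x hx => ?_
    change x = √|x| * √|x| * (x / |x|)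
    rw [Real.mul_self_sqrt (abs_nonneg _), mul_div_cancel₀ _ (abs_ne_zero.2 (h0 x hx))]

/-- The polar decomposition of an injective operator with dense range. -/
theorem exists_polar_of_dense (j : E →L[ℂ] H) (hj : Function.Injective j) (hd : DenseRange j) :
    ∃ (R : H →L[ℂ] H) (W : H ≃ₗᵢ[ℂ] E), R.IsPositive ∧ ∀ x, j (W x) = R x := by
  have hpos : (0 : H →L[ℂ] H) ≤ j ∘L j.adjoint :=
    (ContinuousLinearMap.nonneg_iff_isPositive _).2
      (ContinuousLinearMap.isPositive_self_comp_adjoint j)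
  let R : H →L[ℂ] H := CFC.sqrt (j ∘L j.adjoint)
  have hR : R.IsPositive :=
    (ContinuousLinearMap.nonneg_iff_isPositive _).1 (CFC.sqrt_nonneg _)
  have hRR : R * R = j ∘L j.adjoint := CFC.sqrt_mul_sqrt_self _ hpos
  have hsym : ∀ x y, inner ℂ (R x) y = inner ℂ x (R y) := fun x y =>
    hR.inner_left_eq_inner_right x y
  have hnorm : ∀ x, ‖j.adjoint x‖ = ‖R x‖ := fun x => by
    refine (sq_eq_sq₀ (norm_nonneg _) (norm_nonneg _)).1 ?_
    rw [norm_sq_eq_re_inner (𝕜 := ℂ), norm_sq_eq_re_inner (𝕜 := ℂ), hsym,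
      ContinuousLinearMap.adjoint_inner_left]
    congr 2
    exact (congrArg (fun f : H →L[ℂ] H => f x) hRR).symm
  have hadj0 : ∀ x, j.adjoint x = 0 → x = 0 := fun x hx => by
    refine hd.eq_zero_of_inner_left ℂ fun y => ?_
    rw [← ContinuousLinearMap.adjoint_inner_left, hx, inner_zero_left]
  have hRd : DenseRange R := by
    have : R.range.topologicalClosure = ⊤ := by
      rw [Submodule.topologicalClosure_eq_top_iff, Submodule.eq_bot_iff]
      intro w hw
      rw [Submodule.mem_orthogonal'] at hw
      have h1 : R w = 0 := by
        have := hw (R (R w)) ⟨_, rfl⟩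
        rw [← hsym] at this
        exact inner_self_eq_zero.1 this
      exact hadj0 w (norm_eq_zero.1 (by rw [hnorm, h1, norm_zero]))
    exact Submodule.dense_iff_topologicalClosure_eq_top.2 this
  -- Since `‖j* x‖ = ‖R x‖`, the assignment `R x ↦ j* x` is isometric and extends from the dense
  -- range of `R`. Taking adjoints in `j* = V R` gives the claim once `V` is known to be onto.
  let V : H →L[ℂ] E := (j.adjoint.toLinearMap).extendOfNorm R.toLinearMap
  have hVR : ∀ x, V (R x) = j.adjoint x := fun x =>
    LinearMap.extendOfNorm_eq hRd ⟨1, fun x => by rw [one_mul]; exact (hnorm x).le⟩ x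
  have hV : ∀ x, ‖V x‖ = ‖x‖ := fun x =>
    hRd.induction_on (p := fun x => ‖V x‖ = ‖x‖) x
      (isClosed_eq (by fun_prop) (by fun_prop)) fun y => by rw [hVR, hnorm]
  let V' : H →ₗᵢ[ℂ] E := ⟨V.toLinearMap, hV⟩
  have hsurj : Function.Surjective V' := by
    have hcl : IsClosed (V.range : Set E) := V'.isometry.isClosedEmbedding.isClosed_range
    have : CompleteSpace V.range := hcl.completeSpace_coe
    refine (LinearMap.range_eq_top (f := V.toLinearMap)).1 ?_
    rw [← Submodule.orthogonal_eq_bot_iff, Submodule.eq_bot_iff]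
    intro w hw
    rw [Submodule.mem_orthogonal'] at hw
    -- For `w` orthogonal to the range of `V`, `0 = ⟨w, j* j w⟩ = ‖j w‖²`, and `j` is injective.
    have h1 : j w = 0 := by
      have := hw (V (R (j w))) ⟨_, rfl⟩
      rw [hVR, ContinuousLinearMap.adjoint_inner_right] at this
      exact inner_self_eq_zero.1 this
    exact hj (h1.trans (map_zero j).symm)
  let W := LinearIsometryEquiv.ofSurjective V' hsurj
  refine ⟨R, W, hR, fun x => ext_inner_left ℂ fun y => ?_⟩
  rw [← ContinuousLinearMap.adjoint_inner_left, ← hVR, ← hsym]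
  exact W.inner_map_map (R y) x

/-- A symmetric operator whose adjoint has no larger domain is self-adjoint. -/
theorem isSelfAdjoint_of_adjoint_domain {G : H →ₗ.[ℂ] H} (hd : Dense (G.domain : Set H))
    (hs : ∀ x y : G.domain, inner ℂ (G x) (y : H) = inner ℂ (x : H) (G y))
    (h : ∀ y z : H, (∀ x : G.domain, inner ℂ z (x : H) = inner ℂ y (G x)) → y ∈ G.domain) :
    IsSelfAdjoint G := by
  rw [LinearPMap.isSelfAdjoint_def]
  have h1 : G ≤ G.adjoint := LinearPMap.IsFormalAdjoint.le_adjoint hd hs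
  refine (LinearPMap.eq_of_le_of_domain_eq h1 (le_antisymm h1.1 fun y hy => ?_)).symm
  exact h y _ fun x => LinearPMap.adjoint_isFormalAdjoint hd ⟨y, hy⟩ x

end Operators

/-! ### Symmetric forms as Krein spaces -/

section Forms

variable {H : Type*} [NormedAddCommGroup H] [InnerProductSpace ℂ H] {D : Submodule ℂ H}

theorem zero_mem_perturbations_of_isSymmetric {Φ : SForm D} {N : NormOn D} (hi : N.IsInduced)
    (hc : CompleteSpace N.Space) (hb : IsBoundedOn Φ N) (hs : IsSymmetric Φ) {C : ℝ}
    (h : IsBoundedBelow Φ N C) : 0 ∈ perturbations Φ N :=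
  zero_mem_perturbations_of_boundedBelow hi hc hb h fun η hη => by
    have := h η 0 le_rfl fun ξ => by rw [hs, hη]; simp
    rw [mul_zero] at this
    exact N.definite η (le_antisymm this (N.nonneg η))

/-- The operator on `D[N]` associated with a symmetric form with `0 ∈ P(Φ)`. -/
theorem exists_isUnit_operator {Φ : SForm D} {N : NormOn D} [Fact N.IsInduced]
    [CompleteSpace N.Space] (hb : IsBoundedOn Φ N) (hs : IsSymmetric Φ)
    (h : 0 ∈ perturbations Φ N) : ∃ T : N.Space →L[ℂ] N.Space, IsSelfAdjoint T ∧ IsUnit T ∧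
      ∀ x y : N.Space, inner ℂ y (T x) = Φ (N.out x) (N.out y) := by
  obtain ⟨T, hT⟩ := exists_operator hb
  rw [zero_mem_perturbations_iff] at h
  refine ⟨T, ?_, ?_, hT⟩
  · rw [ContinuousLinearMap.isSelfAdjoint_iff_isSymmetric]
    intro x y
    have h1 := hs (N.out y) (N.out x)
    rw [← hT, ← hT, inner_conj_symm] at h1
    exact h1.symm
  · rw [ContinuousLinearMap.isUnit_iff_bijective]
    refine ⟨(injective_iff_map_eq_zero T).2 fun x hx => h.1 (N.out x) fun y => ?_, fun z => ?_⟩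
    · exact (hT x (N.of y)).symm.trans (by rw [hx, inner_zero_right])
    · obtain ⟨ξ, hξ⟩ := h.2 ((innerSL ℂ).flip z : N.Space →L⋆[ℂ] ℂ)
      exact ⟨N.of ξ, ext_inner_left ℂ fun y => (hT (N.of ξ) y).trans (hξ (N.out y)).symm⟩

theorem isSymmetric_restrict_smul_iota (r : ℝ) : IsSymmetric (restrict D ((r : ℂ) • iota)) :=
  fun ξ η => by
    rw [restrict_smul_iota_apply, restrict_smul_iota_apply, map_mul, Complex.conj_ofReal,
      inner_conj_symm]

/-- Write the operator of `Φ` as `B² J` with `B` invertible and `J` a commuting symmetry. The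
eigenspaces of `J` for `1` and `-1` form the decomposition. The norm it induces is `‖B ·‖`, which is
complete because `B` is invertible. -/
theorem isEmbeddedKrein_of_zero_mem_perturbations {Φ : SForm D} {N : NormOn D}
    (hN : IsEmbeddedHilbert N) (hb : IsBoundedOn Φ N) (hs : IsSymmetric Φ)
    (h : 0 ∈ perturbations Φ N) : IsEmbeddedKrein Φ := by
  have : Fact N.IsInduced := ⟨hN.induced⟩
  have : CompleteSpace N.Space := hN.complete
  obtain ⟨T, hTs, hTu, hT⟩ := exists_isUnit_operator hb hs h
  obtain ⟨J, B, C, hJ, hB, hJJ, hCB, hBC, hJB, hTB⟩ := exists_polar_of_isSelfAdjoint hTs hTu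
  have hJJ' : ∀ x, J (J x) = x := fun x => congrArg (fun f : N.Space →L[ℂ] N.Space => f x) hJJ
  have hCB' : ∀ x, C (B x) = x := fun x => congrArg (fun f : N.Space →L[ℂ] N.Space => f x) hCB
  have hBC' : ∀ x, B (C x) = x := fun x => congrArg (fun f : N.Space →L[ℂ] N.Space => f x) hBC
  have hJB' : ∀ x, J (B x) = B (J x) := fun x =>
    congrArg (fun f : N.Space →L[ℂ] N.Space => f x) hJB
  have hBs : ∀ x y, inner ℂ (B x) y = inner ℂ x (B y) :=
    ContinuousLinearMap.isSelfAdjoint_iff_isSymmetric.1 hB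
  have hJs : ∀ x y, inner ℂ (J x) y = inner ℂ x (J y) :=
    ContinuousLinearMap.isSelfAdjoint_iff_isSymmetric.1 hJ
  have hΦ : ∀ x y : D, Φ x y = inner ℂ (B (N.of y)) (B (J (N.of x))) := fun x y => by
    rw [hBs]
    have := hT (N.of x) (N.of y)
    rw [hTB] at this
    exact this.symm
  have hBi : Function.Injective (B.toLinearMap ∘ₗ N.ofₗ.toLinearMap) :=
    (Function.LeftInverse.injective hCB').comp N.ofₗ.injective
  let P : Submodule ℂ D := (LinearMap.eqLocus J.toLinearMap LinearMap.id).comap N.ofₗ.toLinearMap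
  let M : Submodule ℂ D :=
    (LinearMap.eqLocus J.toLinearMap (-LinearMap.id)).comap N.ofₗ.toLinearMap
  have hP : ∀ x, x ∈ P ↔ J (N.of x) = N.of x := fun x => Iff.rfl
  have hM : ∀ x, x ∈ M ↔ J (N.of x) = -N.of x := fun x => Iff.rfl
  let N' := NormOn.comap _ hBi
  have hN' : ∀ x, N' x = ‖B (N.of x)‖ := fun _ => rfl
  have hort : ∀ p ∈ P, ∀ m ∈ M, inner ℂ (B (N.of m)) (B (N.of p)) = 0 := fun p hp m hm => by
    have h1 : inner ℂ (B (N.of m)) (J (B (N.of p))) = inner ℂ (B (N.of m)) (B (N.of p)) := by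
      rw [hJB', (hP p).1 hp]
    rw [← hJs, hJB', (hM m).1 hm, map_neg, inner_neg_left] at h1
    exact neg_eq_self.1 h1
  have hpos : ∀ x : D, x ≠ 0 → 0 < ‖B (N.of x)‖ ^ 2 := fun x hx => by
    have := N'.pos hx
    rw [hN'] at this
    positivity
  have hΦP : ∀ p ∈ P, (Φ p p).re = ‖B (N.of p)‖ ^ 2 := fun p hp => by
    rw [hΦ, (hP p).1 hp, inner_self_ofReal, Complex.ofReal_re]
  have hΦM : ∀ m ∈ M, (Φ m m).re = -‖B (N.of m)‖ ^ 2 := fun m hm => by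
    rw [hΦ, (hM m).1 hm, map_neg, inner_neg_right, inner_self_ofReal, Complex.neg_re,
      Complex.ofReal_re]
  have hiso : Isometry fun x : N'.Space => B (N.of (N'.out x)) := NormOn.isometry_comap _ hBi
  have hcomp : CompleteSpace N'.Space := NormOn.completeSpace_comap _ hBi (by
    have : Set.range (B.toLinearMap ∘ₗ N.ofₗ.toLinearMap) = Set.univ :=
      Set.eq_univ_of_forall fun x => ⟨N.out (C x), hBC' x⟩
    rw [this]; exact isClosed_univ)
  refine ⟨hs, P, M, N', ?_, fun p hp m hm => ?_, fun p hp hp0 => ?_, fun m hm hm0 => ?_,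
    fun p hp m hm => ?_, ?_, ?_, ?_⟩
  · constructor
    · rw [Submodule.disjoint_def]
      intro x hx hx'
      have h1 : N.of x = -N.of x := ((hP x).1 hx).symm.trans ((hM x).1 hx')
      have h2 : (2 : ℂ) • N.of x = 0 := by
        rw [two_smul]; nth_rewrite 1 [h1]; exact neg_add_cancel _
      exact (smul_eq_zero.1 h2).resolve_left two_ne_zero
    · rw [codisjoint_iff, Submodule.eq_top_iff']
      intro x
      rw [Submodule.mem_sup]
      refine ⟨N.out ((2 : ℂ)⁻¹ • (N.of x + J (N.of x))), ?_,
        N.out ((2 : ℂ)⁻¹ • (N.of x - J (N.of x))), ?_, ?_⟩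
      · rw [hP]
        change J ((2 : ℂ)⁻¹ • (N.of x + J (N.of x))) = (2 : ℂ)⁻¹ • (N.of x + J (N.of x))
        rw [map_smul, map_add, hJJ', add_comm]
      · rw [hM]
        change J ((2 : ℂ)⁻¹ • (N.of x - J (N.of x))) = -((2 : ℂ)⁻¹ • (N.of x - J (N.of x)))
        rw [map_smul, map_sub, hJJ', ← smul_neg, neg_sub]
      · change (2 : ℂ)⁻¹ • (N.of x + J (N.of x)) + (2 : ℂ)⁻¹ • (N.of x - J (N.of x)) = N.of x
        module
  · rw [hΦ, (hP p).1 hp, hort p hp m hm]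
  · rw [hΦP p hp]; exact hpos p hp0
  · rw [hΦM m hm]; linarith [hpos m hm0]
  · rw [hΦP p hp, hΦM m hm, hN', sub_neg_eq_add]
    have e : B (N.of (p + m)) = B (N.of p) + B (N.of m) := map_add B (N.of p) (N.of m)
    rw [e, sq, sq, sq]
    exact norm_add_sq_eq_norm_sq_add_norm_sq_of_inner_eq_zero (𝕜 := ℂ) _ _
      (by rw [← inner_conj_symm, hort p hp m hm, map_zero])
  · have : N'.of '' (P : Set D) = (fun x : N'.Space => B (N.of (N'.out x))) ⁻¹'
        {y | J y = y} := by
      ext x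
      constructor
      · rintro ⟨p, hp, rfl⟩
        change J (B (N.of p)) = B (N.of p)
        rw [hJB', (hP p).1 hp]
      · intro hx
        refine ⟨N'.out x, (hP _).2 (Function.LeftInverse.injective hCB' ?_), rfl⟩
        rw [← hJB']; exact hx
    rw [this]
    exact ((isClosed_eq J.continuous continuous_id).preimage hiso.continuous).isComplete
  · have : N'.of '' (M : Set D) = (fun x : N'.Space => B (N.of (N'.out x))) ⁻¹'
        {y | J y = -y} := by
      ext x
      constructor
      · rintro ⟨p, hp, rfl⟩
        change J (B (N.of p)) = -B (N.of p)
        rw [hJB', (hM p).1 hp, map_neg]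
      · intro hx
        refine ⟨N'.out x, (hM _).2 (Function.LeftInverse.injective hCB' ?_), rfl⟩
        rw [← hJB', map_neg]; exact hx
    rw [this]
    exact ((isClosed_eq J.continuous continuous_neg).preimage hiso.continuous).isComplete
  · obtain ⟨K, hK0, hK⟩ := hN.embeds.exists_pos
    refine ⟨K * ‖C‖, fun ξ => (hK ξ).trans ?_⟩
    rw [mul_assoc, hN']
    refine mul_le_mul_of_nonneg_left ?_ hK0.le
    have := C.le_opNorm (B (N.of ξ))
    rwa [hCB'] at this

theorem isFHSForm_iff {Ω : SForm D} : IsFHSForm Ω ↔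
    ∃ N, IsSolvableInner Ω N ∧ (∀ z ∈ numRange Ω, z.im = 0) ∧
      ∃ l : ℝ, -(l : ℂ) • iota ∈ perturbations Ω N := by
  refine ⟨fun h => h.exists_isSolvableInner, ?_⟩
  rintro ⟨N, hN, him, l, hl⟩
  have hs := isSymmetric_iff_numRange.2 him
  have hE := hN.isEmbeddedHilbert
  refine ⟨hs, l, isEmbeddedKrein_of_zero_mem_perturbations hE
    (hN.2.1.bounded.add (isBoundedOn_restrict hE.embeds _)) (hs.add ?_)
    (mem_perturbations_iff.1 hl)⟩
  rw [← Complex.ofReal_neg]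
  exact isSymmetric_restrict_smul_iota _

/-! ### Forms represented by a positive operator with bounded inverse -/

variable [CompleteSpace H]

/-- The norm `‖G ·‖` is complete because `G` is onto, and `Q⁻¹` supplies the lower bound. -/
theorem IsGKMVForm.exists_isEmbeddedHilbert {Φ : SForm D} (h : IsGKMVForm Φ) :
    IsSymmetric Φ ∧ ∃ N, IsEmbeddedHilbert N ∧ IsBoundedOn Φ N ∧ 0 ∈ perturbations Φ N := by
  obtain ⟨G, Q, ⟨rfl, -, -⟩, ⟨R, hR, hR'⟩, hQ, ⟨q, rfl⟩, hΦ⟩ := h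
  replace hΦ : ∀ x y : G.domain, Φ x y = inner ℂ (G y) (q.1 (G x)) := fun x y =>
    hΦ x y x y rfl rfl
  have hQs : ∀ x y, inner ℂ (q.1 x) y = inner ℂ x (q.1 y) :=
    ContinuousLinearMap.isSelfAdjoint_iff_isSymmetric.1 hQ
  have hs : IsSymmetric Φ := fun x y => by
    rw [hΦ, hΦ, inner_conj_symm, hQs]
  have hGi : Function.Injective G.toFun := fun x y hxy => Subtype.ext <| by
    rw [← hR x, ← hR y]; exact congrArg R hxy
  let N := NormOn.comap G.toFun hGi
  have hN : ∀ x, N x = ‖G x‖ := fun _ => rfl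
  have hc : CompleteSpace N.Space := NormOn.completeSpace_comap _ hGi (by
    have : Set.range G.toFun = Set.univ := Set.eq_univ_of_forall fun y => by
      obtain ⟨x, -, hx⟩ := hR' y
      exact ⟨x, hx⟩
    rw [this]; exact isClosed_univ)
  have hE : IsEmbeddedHilbert N := ⟨NormOn.isInduced_comap _ hGi, hc, ‖R‖, fun x => by
    have := R.le_opNorm (G x)
    rwa [hR] at this⟩
  have hb : IsBoundedOn Φ N := ⟨‖q.1‖, norm_nonneg _, fun x y => by
    rw [hΦ, hN, hN, mul_comm]
    exact (norm_inner_le_norm _ _).trans (by gcongr; exact q.1.le_opNorm _)⟩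
  refine ⟨hs, N, hE, hb, zero_mem_perturbations_of_isSymmetric (C := ‖q.2‖) hE.induced hc hb hs
    fun x B hB hx => ?_⟩
  -- The test vector satisfies `G y = Q G x`, so `Φ x y = ‖Q G x‖²`.
  obtain ⟨y, -, hy⟩ := hR' (q.1 (G x))
  have h1 := hx y
  rw [hΦ, hN, hy, norm_inner_self_eq] at h1
  have h2 : ‖q.1 (G x)‖ ≤ B := by
    rcases (norm_nonneg (q.1 (G x))).eq_or_lt with h0 | h0
    · rwa [← h0]
    · exact le_of_mul_le_mul_right h1 h0
  have h3 : q.2 (q.1 (G x)) = G x := congrArg (fun f : H →L[ℂ] H => f (G x)) q.inv_mul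
  calc N x = ‖q.2 (q.1 (G x))‖ := by rw [h3, hN]
    _ ≤ ‖q.2‖ * ‖q.1 (G x)‖ := q.2.le_opNorm _
    _ ≤ _ := by gcongr

/-- The second representation theorem: a Hilbert space structure on a dense subspace is given by
a positive self-adjoint operator. -/
theorem IsEmbeddedHilbert.exists_operator (hD : Dense (D : Set H)) {N : NormOn D}
    [Fact N.IsInduced] (hN : IsEmbeddedHilbert N) :
    ∃ (G : H →ₗ.[ℂ] H) (W : H ≃ₗᵢ[ℂ] N.Space), IsPositiveSAOn G D ∧ ZeroMemResolvent G ∧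
      ∀ (x : G.domain) (ξ : D), (ξ : H) = x → W (G x) = N.of ξ := by
  have : CompleteSpace N.Space := hN.complete
  obtain ⟨j, hj⟩ := exists_embedding hN.embeds
  obtain ⟨R, W, hR, hW⟩ := exists_polar_of_dense j
    (fun x y hxy => Subtype.ext (by rw [hj, hj] at hxy; exact hxy))
    (by
      have : Set.range j = D := by
        ext x
        constructor
        · rintro ⟨y, rfl⟩
          rw [hj]
          exact (N.out y).2
        · exact fun hx => ⟨N.of ⟨x, hx⟩, hj _⟩
      rw [DenseRange, this]
      exact hD)
  -- `G` is the inverse of the positive operator `R = j W`, whose range is `D`.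
  let G : H →ₗ.[ℂ] H := ⟨D, W.symm.toLinearEquiv.toLinearMap ∘ₗ N.ofₗ.toLinearMap⟩
  have hG : ∀ x : D, G x = W.symm (N.of x) := fun _ => rfl
  have hRG : ∀ x : D, R (G x) = x := fun x => by
    rw [← hW, hG, W.apply_symm_apply, hj]; rfl
  have hGR : ∀ y : H, ∃ x : D, (x : H) = R y ∧ G x = y := fun y =>
    ⟨N.out (W y), by rw [← hj, hW], by
      rw [hG]; exact W.symm_apply_apply y⟩
  refine ⟨G, W, ⟨rfl, isSelfAdjoint_of_adjoint_domain hD (fun x y => ?_) fun y z hyz => ?_,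
    fun x => ?_⟩, ⟨R, hRG, hGR⟩, ?_⟩
  · rw [← hRG y, ← hRG x]
    exact (hR.inner_left_eq_inner_right _ _).symm
  -- Testing the adjoint relation with `x = R w`, for which `G x = w`, gives `⟨y, w⟩ = ⟨z, R w⟩` for
  -- all `w`.
  · have : y = R z := ext_inner_right ℂ fun w => by
      obtain ⟨x, hx, hx'⟩ := hGR w
      have h1 := hyz x
      rw [hx, hx'] at h1
      rw [hR.inner_left_eq_inner_right, h1]
    obtain ⟨x, hx, -⟩ := hGR z
    rw [this, ← hx]
    exact x.2
  · have := hR.re_inner_nonneg_left (G x)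
    rwa [hRG] at this
  · rintro x ξ hξ
    obtain rfl : ξ = x := Subtype.ext hξ
    rw [hG]
    exact W.apply_symm_apply _

/-- `W G` is the identity from `D` to `D[N]`, so conjugating the operator of `Φ` by the unitary `W`
yields `Q`. -/
theorem isGKMVForm_of_zero_mem_perturbations (hD : Dense (D : Set H)) {Φ : SForm D}
    {N : NormOn D} (hN : IsEmbeddedHilbert N) (hb : IsBoundedOn Φ N) (hs : IsSymmetric Φ)
    (h : 0 ∈ perturbations Φ N) : IsGKMVForm Φ := by
  have : Fact N.IsInduced := ⟨hN.induced⟩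
  have : CompleteSpace N.Space := hN.complete
  obtain ⟨T, hTs, hTu, hT⟩ := exists_isUnit_operator hb hs h
  obtain ⟨G, W, hG, hG0, hW⟩ := hN.exists_operator hD
  have hTs' : ∀ x y, inner ℂ (T x) y = inner ℂ x (T y) :=
    ContinuousLinearMap.isSelfAdjoint_iff_isSymmetric.1 hTs
  let Q : H →L[ℂ] H := (W.symm : N.Space →L[ℂ] H) ∘L T ∘L (W : H →L[ℂ] N.Space)
  have hQ : ∀ x, Q x = W.symm (T (W x)) := fun _ => rfl
  refine ⟨G, Q, hG, hG0, ?_, ?_, fun x y ξ η hξ hη => ?_⟩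
  · rw [ContinuousLinearMap.isSelfAdjoint_iff_isSymmetric]
    intro x y
    change inner ℂ (Q x) y = inner ℂ x (Q y)
    rw [← W.inner_map_map, ← W.inner_map_map x, hQ, hQ, W.apply_symm_apply, W.apply_symm_apply,
      hTs']
  · rw [ContinuousLinearMap.isUnit_iff_bijective] at hTu ⊢
    exact W.symm.bijective.comp (hTu.comp W.bijective)
  · rw [hQ, ← W.inner_map_map, W.apply_symm_apply, hW x ξ hξ, hW y η hη, hT]
    rfl

theorem isGKMVForm_iff (hD : Dense (D : Set H)) {Ω : SForm D} : IsGKMVForm Ω ↔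
    ∃ N, IsSolvableInner Ω N ∧ (∀ z ∈ numRange Ω, z.im = 0) ∧ 0 ∈ perturbations Ω N := by
  constructor
  · intro h
    obtain ⟨hs, N, hN, hb, h0⟩ := h.exists_isEmbeddedHilbert
    exact ⟨N, hN.isSolvableInner hb h0, isSymmetric_iff_numRange.1 hs, h0⟩
  · rintro ⟨N, hN, him, h0⟩
    exact isGKMVForm_of_zero_mem_perturbations hD hN.isEmbeddedHilbert hN.2.1.bounded
      (isSymmetric_iff_numRange.2 him) h0

end Forms

/-- The isometric embedding of `V[N]` for the norm `N x = ‖f x‖`. -/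
noncomputable def NormOn.comapₗᵢ {V F : Type*} [AddCommGroup V] [Module ℂ V]
    [NormedAddCommGroup F] [NormedSpace ℂ F] (f : V →ₗ[ℂ] F) (hf : Function.Injective f) :
    (NormOn.comap f hf).Space →ₗᵢ[ℂ] F :=
  ⟨f ∘ₗ (NormOn.comap f hf).ofₗ.symm.toLinearMap, fun _ => rfl⟩

/-! ### Schmitz: forms perturbed by a bounded operator -/

section Forms

variable {H : Type*} [NormedAddCommGroup H] [InnerProductSpace ℂ H] [CompleteSpace H]
  {D : Submodule ℂ H}

theorem isSymmetric_restrict_opForm {K : H →L[ℂ] H} (hK : IsSelfAdjoint K) :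
    IsSymmetric (restrict D (opForm K)) := fun ξ η => by
  rw [restrict_apply, restrict_apply, opForm_apply, opForm_apply, inner_conj_symm]
  exact (ContinuousLinearMap.isSelfAdjoint_iff_isSymmetric.1 hK (η : H) (ξ : H)).symm

theorem isSymmetric_of_add_opForm {Ω : SForm D} {K : H →L[ℂ] H} (hK : IsSelfAdjoint K)
    (h : IsSymmetric (Ω + restrict D (opForm K))) : IsSymmetric Ω := fun ξ η => by
  have h1 := h ξ η
  simp only [LinearMap.add_apply, map_add] at h1
  rw [← isSymmetric_restrict_opForm hK ξ η] at h1
  exact add_right_cancel h1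

theorem IsSchmitzForm.exists_isSolvableInner {Ω : SForm D} {K : H →L[ℂ] H}
    (h : IsSchmitzForm Ω K) : ∃ N, IsSolvableInner Ω N ∧ (∀ z ∈ numRange Ω, z.im = 0) ∧
      opForm K ∈ perturbations Ω N := by
  obtain ⟨hK, hG⟩ := h
  obtain ⟨hs, hZ⟩ := hG.exists_isEmbeddedHilbert
  obtain ⟨N, hN, hU⟩ := isZeroClosed_add_restrict_iff.1 (isZeroClosed_iff.2 hZ)
  exact ⟨N, hN, isSymmetric_iff_numRange.1 (isSymmetric_of_add_opForm hK hs), hU⟩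

theorem IsOffDiagonalForm.exists_isSolvableInner {Ω : SForm D} {J : H →L[ℂ] H}
    (h : IsOffDiagonalForm Ω J) : ∃ N, IsSolvableInner Ω N ∧ (∀ z ∈ numRange Ω, z.im = 0) ∧
      opForm J ∈ perturbations Ω N := by
  obtain ⟨hJ, hJJ, S, v, ⟨rfl, hS, -⟩, hJS, hv, hvJ, ⟨β, hβ⟩, hΩ⟩ := h
  have hJs : ∀ x y, inner ℂ (J x) y = inner ℂ x (J y) :=
    ContinuousLinearMap.isSelfAdjoint_iff_isSymmetric.1 hJ
  have hJn : ∀ x, ‖J x‖ = ‖x‖ := fun x => by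
    refine (sq_eq_sq₀ (norm_nonneg _) (norm_nonneg _)).1 ?_
    rw [norm_sq_eq_re_inner (𝕜 := ℂ), norm_sq_eq_re_inner (𝕜 := ℂ), hJs, hJJ]
  choose σ hσ hSσ using hJS
  let Φ := Ω + restrict S.domain (opForm J)
  have hΦ : ∀ x y : S.domain, Φ x y = inner ℂ (S y) (J (S x)) + v x y
      + inner ℂ (y : H) (J x) := fun x y => by
    change Ω x y + inner ℂ (y : H) (J x) = _
    rw [hΩ x y x y rfl rfl]
  have hΦs : IsSymmetric Φ := fun x y => by
    rw [hΦ, hΦ, map_add, map_add, inner_conj_symm, inner_conj_symm, ← hv, hJs, hJs]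
  let f : S.domain →ₗ[ℂ] WithLp 2 (H × H) :=
    (WithLp.linearEquiv 2 ℂ (H × H)).symm.toLinearMap ∘ₗ S.domain.subtype.prod S.toFun
  have hf : Function.Injective f := fun x y hxy =>
    Subtype.ext (congrArg (fun z : WithLp 2 (H × H) => z.fst) hxy)
  have hinner : ∀ x y, inner ℂ (f y) (f x) = inner ℂ (y : H) (x : H) + inner ℂ (S y) (S x) :=
    fun x y => WithLp.prod_inner_apply _ _
  have hclosed : IsClosed (Set.range f) := by
    have : Set.range f = (WithLp.ofLp : WithLp 2 (H × H) → H × H) ⁻¹' (S.graph : Set (H × H)) := by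
      ext x
      constructor
      · rintro ⟨y, rfl⟩
        exact LinearPMap.mem_graph S y
      · intro hx
        obtain ⟨y, hy, hy'⟩ := (LinearPMap.mem_graph_iff S).1 hx
        exact ⟨y, (WithLp.ofLp_injective 2) (Prod.ext hy hy')⟩
    rw [this]
    exact IsClosed.preimage (WithLp.prod_continuous_ofLp 2 H H) hS.isClosed
  let N := NormOn.comap f hf
  have hi : N.IsInduced := NormOn.isInduced_comap f hf
  have hc : CompleteSpace N.Space := NormOn.completeSpace_comap f hf hclosed
  have : Fact N.IsInduced := ⟨hi⟩
  have hN : ∀ x, N x ^ 2 = ‖(x : H)‖ ^ 2 + ‖S x‖ ^ 2 := fun x =>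
    WithLp.prod_norm_sq_eq_of_L2 (f x)
  have hNi : ∀ x y : S.domain, inner ℂ (N.of y) (N.of x)
      = inner ℂ (y : H) (x : H) + inner ℂ (S y) (S x) := fun x y => by
    rw [← hinner]
    exact ((NormOn.comapₗᵢ f hf).inner_map_map (N.of y) (N.of x)).symm
  -- In the graph norm, adding `⟨J ·, ·⟩` completes `⟨J S ·, S ·⟩` to the form of the isometric
  -- involution `σ`.
  have hΦN : ∀ x y, Φ x y = inner ℂ (N.of y) (N.of (σ x)) + v x y := fun x y => by
    rw [hΦ, hNi, hσ, hSσ]; ring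
  have hNσ : ∀ x, N (σ x) = N x := fun x => by
    refine (sq_eq_sq₀ (N.nonneg _) (N.nonneg _)).1 ?_
    rw [hN, hN, hσ, hSσ, hJn, hJn]
  have hE : IsEmbeddedHilbert N := ⟨hi, hc, 1, fun x => by
    rw [one_mul]
    refine abs_le_of_sq_le_sq' ?_ (N.nonneg x) |>.2
    rw [hN]
    linarith [sq_nonneg ‖S x‖]⟩
  have hvb : IsBoundedOn v N := isBoundedOn_of_diag (abs_nonneg β) fun x => by
    rw [hN, add_comm]
    exact (hβ x x rfl).trans (mul_le_mul_of_nonneg_right (le_abs_self β) (by positivity))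
  obtain ⟨V, hV⟩ := exists_operator hvb
  have hΦb : IsBoundedOn Φ N := by
    obtain ⟨b, hb0, hb⟩ := hvb
    refine ⟨1 + b, by positivity, fun x y => ?_⟩
    rw [hΦN]
    calc _ ≤ ‖inner ℂ (N.of y) (N.of (σ x))‖ + ‖v x y‖ := norm_add_le _ _
      _ ≤ N y * N (σ x) + b * N x * N y := add_le_add (norm_inner_le_norm _ _) (hb x y)
      _ = _ := by rw [hNσ]; ring
  -- Off-diagonality and symmetry make `v x (σ x)` purely imaginary. The cross term in `‖(σ + V)
  -- x‖²` then vanishes, so the norm is at least `N x` however large `β` is.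
  have hre : ∀ x, (v x (σ x)).re = 0 := fun x => by
    have h1 : v (σ x) x = -v x (σ x) :=
      hvJ x (σ x) (σ x) x (hσ x) (by rw [hσ, hJJ])
    rw [hv] at h1
    have := congrArg Complex.re h1
    rw [Complex.conj_re, Complex.neg_re] at this
    linarith
  have hbl : IsBoundedBelow Φ N 1 := fun x M hM hx => by
    let y : N.Space := N.of (σ x) + V (N.of x)
    have hy : Φ x (N.out y) = inner ℂ y y := by
      rw [hΦN]
      change inner ℂ y (N.of (σ x)) + v (N.out (N.of x)) (N.out y) = _
      rw [← hV, ← inner_add_right]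
    have h1 : ‖y‖ * ‖y‖ ≤ M * ‖y‖ := by
      rw [← norm_inner_self_eq, ← hy]
      exact hx (N.out y)
    have h2 : ‖y‖ ≤ M := by
      rcases (norm_nonneg y).eq_or_lt with h0 | h0
      · rwa [← h0]
      · exact le_of_mul_le_mul_right h1 h0
    have h3 : N x ^ 2 ≤ ‖y‖ ^ 2 := by
      rw [norm_add_sq (𝕜 := ℂ), hV]
      change N x ^ 2 ≤ N (σ x) ^ 2 + 2 * (v x (σ x)).re + _
      rw [hNσ, hre]
      have := sq_nonneg ‖V (N.of x)‖
      linarith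
    rw [one_mul]
    exact (abs_le_of_sq_le_sq' h3 (norm_nonneg _)).2.trans h2
  obtain ⟨N₁, hN₁, hU⟩ := isZeroClosed_add_restrict_iff.1 (isZeroClosed_iff.2
    ⟨N, hE, hΦb, zero_mem_perturbations_of_isSymmetric hi hc hΦb hΦs hbl⟩)
  exact ⟨N₁, hN₁, isSymmetric_iff_numRange.1 (isSymmetric_of_add_opForm hJ hΦs), hU⟩

end Forms

/-! ### The diagonal example on `ℓ²(ℕ)` -/

section Diagonal

/-- The Hilbert space `ℓ²(ℕ)`. -/
abbrev SeqSpace : Type := lp (fun _ : ℕ => ℂ) 2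

/-- The unit vectors of `ℓ²(ℕ)`. -/
noncomputable def unitVec (n : ℕ) : SeqSpace := lp.single 2 n (1 : ℂ)

theorem unitVec_apply_self (n : ℕ) : unitVec n n = 1 := Pi.single_eq_same _ _

theorem unitVec_apply_ne {n m : ℕ} (h : m ≠ n) : unitVec n m = 0 := Pi.single_eq_of_ne h _

theorem inner_unitVec_left (n : ℕ) (x : SeqSpace) : inner ℂ (unitVec n) x = x n := by
  rw [unitVec, lp.inner_single_left]; simp

theorem inner_unitVec_right (n : ℕ) (x : SeqSpace) : inner ℂ x (unitVec n) = conj (x n) := by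
  rw [← inner_conj_symm, inner_unitVec_left]

theorem norm_unitVec (n : ℕ) : ‖unitVec n‖ = 1 := by
  rw [unitVec, lp.norm_single (by norm_num)]; simp

/-- The maximal multiplication operator by a real sequence on `ℓ²(ℕ)`. -/
noncomputable def diag (a : ℕ → ℝ) : SeqSpace →ₗ.[ℂ] SeqSpace where
  domain :=
    { carrier := {x | Memℓp (fun n => (a n : ℂ) * x n) 2}
      add_mem' := fun {x y} hx hy => by
        change Memℓp (fun n => (a n : ℂ) * (x + y) n) 2
        convert hx.add hy using 1
        ext n
        simp [mul_add]
      zero_mem' := by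
        change Memℓp (fun n => (a n : ℂ) * (0 : SeqSpace) n) 2
        convert (zero_memℓp (E := fun _ : ℕ => ℂ) (p := 2)) using 1
        ext n
        simp
      smul_mem' := fun c x hx => by
        change Memℓp (fun n => (a n : ℂ) * (c • x) n) 2
        convert hx.const_smul c using 1
        ext n
        simp [mul_left_comm] }
  toFun :=
    { toFun := fun x => ⟨fun n => (a n : ℂ) * x.1 n, x.2⟩
      map_add' := fun x y => by ext n; exact mul_add _ _ _
      map_smul' := fun c x => by ext n; exact mul_left_comm _ _ _ }

theorem mem_diag_domain {a : ℕ → ℝ} {x : SeqSpace} :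
    x ∈ (diag a).domain ↔ Memℓp (fun n => (a n : ℂ) * x n) 2 := Iff.rfl

theorem diag_apply (a : ℕ → ℝ) (x : (diag a).domain) (n : ℕ) :
    diag a x n = (a n : ℂ) * (x : SeqSpace) n := rfl

theorem single_mem_diag_domain (a : ℕ → ℝ) (n : ℕ) (c : ℂ) :
    lp.single 2 n c ∈ (diag a).domain := by
  rw [mem_diag_domain]
  convert lp.memℓp (lp.single (E := fun _ : ℕ => ℂ) 2 n ((a n : ℂ) * c)) using 1
  ext m
  rcases eq_or_ne m n with rfl | h
  · simp
  · simp [Pi.single_eq_of_ne h]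

theorem dense_diag_domain (a : ℕ → ℝ) : Dense ((diag a).domain : Set SeqSpace) := fun x =>
  mem_closure_of_tendsto (lp.hasSum_single (by norm_num) x) <| Eventually.of_forall fun s =>
    Submodule.sum_mem _ fun n _ => single_mem_diag_domain a n _

theorem isPositiveSAOn_diag {a : ℕ → ℝ} (ha : ∀ n, 0 ≤ a n) :
    IsPositiveSAOn (diag a) (diag a).domain := by
  refine ⟨rfl, isSelfAdjoint_of_adjoint_domain (dense_diag_domain a) (fun x y => ?_)
    fun y z h => ?_, fun x => ?_⟩
  · refine (lp.hasSum_inner (𝕜 := ℂ) _ _).unique ?_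
    convert! lp.hasSum_inner (𝕜 := ℂ) (x : SeqSpace) (diag a y) using 1
    ext n
    rw [diag_apply, diag_apply]
    simp only [RCLike.inner_apply, map_mul, Complex.conj_ofReal]
    ring
  · rw [mem_diag_domain]
    convert lp.memℓp z using 1
    ext n
    -- The unit vectors identify the components: `z n = a n * y n`, so square summability of `z`
    -- puts `y` in the domain.
    have h1 := h ⟨unitVec n, single_mem_diag_domain a n 1⟩
    have h2 : diag a ⟨unitVec n, single_mem_diag_domain a n 1⟩ = (a n : ℂ) • unitVec n := by
      ext m
      rw [diag_apply, lp.coeFn_smul, Pi.smul_apply, smul_eq_mul]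
      rcases eq_or_ne m n with rfl | hm
      · rfl
      · rw [unitVec_apply_ne hm, mul_zero, mul_zero]
    rw [h2, inner_smul_right, inner_unitVec_right, inner_unitVec_right] at h1
    have h3 := congrArg conj h1
    rw [map_mul, Complex.conj_conj, Complex.conj_conj, Complex.conj_ofReal] at h3
    exact h3.symm
  · rw [← Complex.zero_re, Complex.zero_re, lp.inner_eq_tsum,
      Complex.re_tsum (lp.summable_inner _ _)]
    refine tsum_nonneg fun n => ?_
    have : inner ℂ ((x : SeqSpace) n) (diag a x n)
        = ((a n * ‖(x : SeqSpace) n‖ ^ 2 : ℝ) : ℂ) := by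
      rw [diag_apply, RCLike.inner_apply, mul_assoc, Complex.mul_conj']
      push_cast; ring
    rw [this, Complex.ofReal_re]
    exact mul_nonneg (ha n) (sq_nonneg _)

/-- The multiplication operator by a real sequence with values in `[-1, 1]`. -/
noncomputable def diagCLM (a : ℕ → ℝ) (ha : ∀ n, |a n| ≤ 1) : SeqSpace →L[ℂ] SeqSpace :=
  lp.mapCLM 2 (fun n => (a n : ℂ) • ContinuousLinearMap.id ℂ ℂ) zero_le_one fun n => by
    rw [norm_smul, Complex.norm_real, Real.norm_eq_abs]
    exact mul_le_one₀ (ha n) (norm_nonneg _) ContinuousLinearMap.norm_id_le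

theorem diagCLM_apply (a : ℕ → ℝ) (ha : ∀ n, |a n| ≤ 1) (x : SeqSpace) (n : ℕ) :
    diagCLM a ha x n = (a n : ℂ) * x n := rfl

theorem isSelfAdjoint_diagCLM (a : ℕ → ℝ) (ha : ∀ n, |a n| ≤ 1) :
    IsSelfAdjoint (diagCLM a ha) := by
  rw [ContinuousLinearMap.isSelfAdjoint_iff_isSymmetric]
  intro x y
  refine (lp.hasSum_inner (𝕜 := ℂ) _ _).unique ?_
  convert! lp.hasSum_inner (𝕜 := ℂ) x (diagCLM a ha y) using 1
  ext n
  change inner ℂ (diagCLM a ha x n) (y n) = _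
  rw [diagCLM_apply, diagCLM_apply]
  simp only [RCLike.inner_apply, map_mul, Complex.conj_ofReal]
  ring

/-- A dense sequence of real numbers. -/
noncomputable def realSeq (n : ℕ) : ℝ := TopologicalSpace.denseSeq ℝ n

theorem exists_realSeq_near (r : ℝ) {ε : ℝ} (hε : 0 < ε) : ∃ n, |realSeq n - r| < ε := by
  obtain ⟨n, hn⟩ := (TopologicalSpace.denseRange_denseSeq ℝ).exists_dist_lt r hε
  refine ⟨n, ?_⟩
  rw [← Real.dist_eq, dist_comm]
  exact hn

/-- The sign of the terms of the dense sequence. -/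
noncomputable def signSeq (n : ℕ) : ℝ := if 0 ≤ realSeq n then 1 else -1

theorem signSeq_mul_self (n : ℕ) : signSeq n * signSeq n = 1 := by
  unfold signSeq; split_ifs <;> norm_num

theorem abs_signSeq_le (n : ℕ) : |signSeq n| ≤ 1 := by
  unfold signSeq; split_ifs <;> norm_num

theorem signSeq_mul_abs (n : ℕ) : signSeq n * |realSeq n| = realSeq n := by
  unfold signSeq
  split_ifs with h
  · rw [abs_of_nonneg h, one_mul]
  · rw [abs_of_neg (not_le.1 h), neg_one_mul, neg_neg]

/-- The multiplication operator by `|realSeq|^(1/2)`. -/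
noncomputable def sqrtDiag : SeqSpace →ₗ.[ℂ] SeqSpace := diag fun n => √|realSeq n|

/-- The multiplication operator by `(1 + |realSeq|)^(1/2)`. -/
noncomputable def sqrtOneAddDiag : SeqSpace →ₗ.[ℂ] SeqSpace := diag fun n => √(1 + |realSeq n|)

theorem sqrtDiag_apply (x : sqrtDiag.domain) (n : ℕ) :
    sqrtDiag x n = (√|realSeq n| : ℝ) * (x : SeqSpace) n := rfl

theorem sqrtOneAddDiag_apply (x : sqrtOneAddDiag.domain) (n : ℕ) :
    sqrtOneAddDiag x n = (√(1 + |realSeq n|) : ℝ) * (x : SeqSpace) n := rfl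

/-- This rests on `√|t| ≤ √(1 + |t|) ≤ √|t| + 1`. -/
theorem sqrtOneAddDiag_domain : sqrtOneAddDiag.domain = sqrtDiag.domain := by
  ext x
  constructor
  · intro hx
    have hx' := mem_diag_domain.1 hx
    refine mem_diag_domain.2 (hx'.norm.mono fun n => ?_)
    rw [norm_mul, norm_mul, Complex.norm_real, Complex.norm_real,
      Real.norm_of_nonneg (Real.sqrt_nonneg _), Real.norm_of_nonneg (Real.sqrt_nonneg _)]
    gcongr
    linarith
  · intro hx
    have hx' := mem_diag_domain.1 hx
    refine mem_diag_domain.2 ((hx'.norm.add (lp.memℓp x).norm).mono fun n => ?_)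
    rw [Pi.add_apply, norm_mul, norm_mul, Complex.norm_real, Complex.norm_real,
      Real.norm_of_nonneg (Real.sqrt_nonneg _), Real.norm_of_nonneg (Real.sqrt_nonneg _),
      ← add_one_mul]
    gcongr
    rw [Real.sqrt_le_left (by positivity), add_sq, Real.sq_sqrt (abs_nonneg _)]
    nlinarith [Real.sqrt_nonneg |realSeq n|]

/-- The multiplication operator by `signSeq`. -/
noncomputable def signCLM : SeqSpace →L[ℂ] SeqSpace := diagCLM signSeq abs_signSeq_le

theorem signCLM_apply (x : SeqSpace) (n : ℕ) : signCLM x n = (signSeq n : ℂ) * x n := rfl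

theorem signCLM_apply_apply (x : SeqSpace) : signCLM (signCLM x) = x := by
  ext n
  rw [signCLM_apply, signCLM_apply, ← mul_assoc, ← Complex.ofReal_mul,
    signSeq_mul_self, Complex.ofReal_one, one_mul]

/-- The form with diagonal entries `realSeq`. -/
noncomputable def diagForm : SForm sqrtDiag.domain :=
  LinearMap.mk₂'ₛₗ (RingHom.id ℂ) (starRingEnd ℂ)
    (fun x y => inner ℂ (sqrtDiag y) (signCLM (sqrtDiag x)))
    (fun x y z => by rw [LinearPMap.map_add, map_add, inner_add_right])
    (fun c x y => by rw [LinearPMap.map_smul, map_smul, inner_smul_right]; rfl)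
    (fun x y z => by rw [LinearPMap.map_add, inner_add_left])
    (fun c x y => by rw [LinearPMap.map_smul, inner_smul_left]; rfl)

theorem diagForm_apply (x y : sqrtDiag.domain) :
    diagForm x y = inner ℂ (sqrtDiag y) (signCLM (sqrtDiag x)) := rfl

theorem hasSum_diagForm (x y : sqrtDiag.domain) :
    HasSum (fun n => (realSeq n : ℂ) * inner ℂ ((y : SeqSpace) n) ((x : SeqSpace) n))
      (diagForm x y) := by
  rw [diagForm_apply]
  convert! lp.hasSum_inner (𝕜 := ℂ) (sqrtDiag y) (signCLM (sqrtDiag x)) using 1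
  ext n
  have h : (realSeq n : ℂ) = signSeq n * (√|realSeq n| * √|realSeq n| : ℝ) := by
    rw [Real.mul_self_sqrt (abs_nonneg _), ← Complex.ofReal_mul, signSeq_mul_abs]
  rw [signCLM_apply, sqrtDiag_apply, sqrtDiag_apply, h]
  simp only [RCLike.inner_apply, map_mul, Complex.conj_ofReal]
  push_cast
  ring

theorem isOffDiagonalForm_diagForm : IsOffDiagonalForm diagForm signCLM := by
  refine ⟨isSelfAdjoint_diagCLM _ _, signCLM_apply_apply, sqrtDiag, 0,
    isPositiveSAOn_diag fun n => Real.sqrt_nonneg _, fun x => ?_, fun ξ η => ?_,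
    fun ξ η ξ' η' _ _ => ?_, ⟨0, fun x ξ _ => ?_⟩, fun x y ξ η hx hy => ?_⟩
  · have hx : signCLM x ∈ sqrtDiag.domain := mem_diag_domain.2 <| by
      convert lp.memℓp (signCLM (sqrtDiag x)) using 1
      ext n
      rw [signCLM_apply]
      change _ = (signSeq n : ℂ) * ((√|realSeq n| : ℝ) * (x : SeqSpace) n)
      ring
    refine ⟨⟨_, hx⟩, rfl, ?_⟩
    ext n
    exact mul_left_comm _ _ _
  · simp
  · simp
  · simp
  · obtain rfl : ξ = x := Subtype.ext hx
    obtain rfl : η = y := Subtype.ext hy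
    rw [diagForm_apply, LinearMap.zero_apply, LinearMap.zero_apply, add_zero]

/-- Adding the sign to each entry gives `sign * (1 + |entry|)`, so `Q` is the sign operator and `G`
is multiplication by `√(1 + |entry|) ≥ 1`. -/
theorem isSchmitzForm_diagForm : IsSchmitzForm diagForm signCLM := by
  refine ⟨isSelfAdjoint_diagCLM _ _, sqrtOneAddDiag, signCLM, ?_, ?_, isSelfAdjoint_diagCLM _ _,
    ?_, fun x y ξ η hx hy => ?_⟩
  · rw [← sqrtOneAddDiag_domain]
    exact isPositiveSAOn_diag fun n => Real.sqrt_nonneg _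
  · have h0 : ∀ n, 0 < √(1 + |realSeq n|) := fun n => Real.sqrt_pos.2 (by positivity)
    have h1 : ∀ n, |(√(1 + |realSeq n|))⁻¹| ≤ 1 := fun n => by
      rw [abs_of_nonneg (inv_nonneg.2 (h0 n).le)]
      refine inv_le_one_of_one_le₀ ?_
      rw [Real.one_le_sqrt]
      linarith [abs_nonneg (realSeq n)]
    have h2 : ∀ n, ((√(1 + |realSeq n|) : ℝ) : ℂ) ≠ 0 := fun n => by exact_mod_cast (h0 n).ne'
    have h3 : ∀ y n, ((√(1 + |realSeq n|) : ℝ) : ℂ) * diagCLM _ h1 y n = y n := fun y n => by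
      rw [diagCLM_apply, Complex.ofReal_inv, mul_inv_cancel_left₀ (h2 n)]
    refine ⟨diagCLM _ h1, fun x => ?_, fun y => ?_⟩
    · ext n
      rw [diagCLM_apply, sqrtOneAddDiag_apply, Complex.ofReal_inv,
        inv_mul_cancel_left₀ (h2 n)]
    · refine ⟨⟨diagCLM _ h1 y, mem_diag_domain.2 ?_⟩, rfl, ?_⟩
      · convert lp.memℓp y using 1
        ext n
        exact h3 y n
      · ext n
        exact h3 y n
  · refine ⟨⟨signCLM, signCLM, ?_, ?_⟩, rfl⟩ <;>
      exact ContinuousLinearMap.ext signCLM_apply_apply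
  · rw [LinearMap.add_apply, LinearMap.add_apply, restrict_apply, opForm_apply]
    refine HasSum.unique ((hasSum_diagForm ξ η).add (lp.hasSum_inner (𝕜 := ℂ) _ _)) ?_
    convert! lp.hasSum_inner (𝕜 := ℂ) (sqrtOneAddDiag y) (signCLM (sqrtOneAddDiag x)) using 1
    ext n
    have h : (signSeq n : ℂ) * (√(1 + |realSeq n|) * √(1 + |realSeq n|) : ℝ)
        = signSeq n + realSeq n := by
      rw [Real.mul_self_sqrt (by positivity)]
      conv_rhs => rw [← signSeq_mul_abs]
      push_cast
      ring
    rw [signCLM_apply, signCLM_apply, sqrtOneAddDiag_apply, sqrtOneAddDiag_apply, hx, hy]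
    simp only [RCLike.inner_apply, map_mul, Complex.conj_ofReal]
    push_cast at h
    linear_combination (-conj ((y : SeqSpace) n) * (x : SeqSpace) n) * h

theorem opForm_signCLM_ne (c : ℂ) : opForm signCLM ≠ c • iota := fun h => by
  have key : ∀ n, (signSeq n : ℂ) = c := fun n => by
    have h1 := congrArg (fun U : BForm SeqSpace => U (unitVec n) (unitVec n)) h
    have h2 : inner ℂ (unitVec n) (signCLM (unitVec n))
        = c * inner ℂ (unitVec n) (unitVec n) := h1
    rw [inner_unitVec_left, inner_unitVec_left, signCLM_apply,
      unitVec_apply_self, mul_one, mul_one] at h2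
    exact h2
  -- Density provides entries of both signs.
  obtain ⟨n, hn⟩ := exists_realSeq_near 1 one_pos
  obtain ⟨m, hm⟩ := exists_realSeq_near (-1) one_pos
  have hn' : 0 ≤ realSeq n := by linarith [(abs_lt.1 hn).1]
  have hm' : ¬ 0 ≤ realSeq m := by linarith [(abs_lt.1 hm).2]
  have h1 := (key n).trans (key m).symm
  rw [signSeq, signSeq, if_pos hn', if_neg hm'] at h1
  norm_num at h1

/-- Some entry is arbitrarily close to `l`. At its unit vector the shifted functional is arbitrarily
small, while the continuous embedding bounds the norm of that vector from below. This contradicts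
the lower bound for any admissible norm. -/
theorem smul_iota_notMem_perturbations_diagForm {N : NormOn sqrtDiag.domain}
    (hN : IsSolvableInner diagForm N) (l : ℝ) :
    -(l : ℂ) • iota ∉ perturbations diagForm N := fun h => by
  have hE := hN.isEmbeddedHilbert
  obtain ⟨K, hK0, hK⟩ := hE.embeds.exists_pos
  obtain ⟨C, hC, hbl⟩ := exists_isBoundedBelow hE.complete
    (hN.2.1.bounded.add (isBoundedOn_restrict hE.embeds _)) (mem_perturbations_iff.1 h)
  -- The tolerance is chosen to contradict `1 = ‖e‖ ≤ K * N e ≤ K * C * |realSeq n - l| * K`.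
  obtain ⟨n, hn⟩ := exists_realSeq_near l (ε := (C * K * K)⁻¹) (by positivity)
  let e : sqrtDiag.domain := ⟨unitVec n, single_mem_diag_domain _ n 1⟩
  have he : ‖(e : SeqSpace)‖ = 1 := norm_unitVec n
  have h1 : ∀ η : sqrtDiag.domain, (diagForm + restrict sqrtDiag.domain (-(l : ℂ) • iota)) e η
      = ((realSeq n - l : ℝ) : ℂ) * inner ℂ (η : SeqSpace) (e : SeqSpace) := fun η => by
    have h2 : diagForm e η = (realSeq n : ℂ) * inner ℂ (η : SeqSpace) (e : SeqSpace) := by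
      refine (hasSum_diagForm e η).unique ?_
      convert! (lp.hasSum_inner (𝕜 := ℂ) (η : SeqSpace) (e : SeqSpace)).mul_left
        (realSeq n : ℂ) using 1
      ext m
      rcases eq_or_ne m n with rfl | hm
      · rfl
      · have : (e : SeqSpace) m = 0 := Pi.single_eq_of_ne hm _
        rw [this, inner_zero_right, mul_zero, mul_zero]
    rw [LinearMap.add_apply, LinearMap.add_apply, restrict_smul_iota_apply, h2]
    push_cast
    ring
  have h2 : N e ≤ C * (|realSeq n - l| * K) := hbl e _ (by positivity) fun η => by
    rw [h1, norm_mul, Complex.norm_real, Real.norm_eq_abs, mul_assoc]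
    gcongr
    have := norm_inner_le_norm (𝕜 := ℂ) (η : SeqSpace) (e : SeqSpace)
    rw [he, mul_one] at this
    exact this.trans (hK η)
  have h3 := hK e
  rw [he] at h3
  have h4 : C * K * K * |realSeq n - l| < 1 := by
    rwa [← mul_one (C * K * K)⁻¹, lt_inv_mul_iff₀ (by positivity)] at hn
  nlinarith

end Diagonal

end SolvableForms

/-! ### The eight items together -/

theorem lemma4p1 {H : Type*} [NormedAddCommGroup H] [InnerProductSpace ℂ H] [CompleteSpace H]
    (D : Submodule ℂ H) (hD : Dense (D : Set H)) (Ω : SolvableForms.SForm D) :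
    -- 1. Fleige, Hassi, de Snoo
    (SolvableForms.IsFHSForm Ω ↔
      ∃ N, SolvableForms.IsSolvableInner Ω N ∧
        (∀ z ∈ SolvableForms.numRange Ω, z.im = 0) ∧
        ∃ l : ℝ, -(l : ℂ) • SolvableForms.iota ∈ SolvableForms.perturbations Ω N) ∧
    -- 2. Grubišić, Kostrykin, Makarov, Veselić
    (SolvableForms.IsGKMVForm Ω ↔
      ∃ N, SolvableForms.IsSolvableInner Ω N ∧
        (∀ z ∈ SolvableForms.numRange Ω, z.im = 0) ∧
        0 ∈ SolvableForms.perturbations Ω N) ∧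
    -- 3. Kato, symmetric forms
    ((SolvableForms.IsSymmetric Ω ∧ SolvableForms.IsKatoForm Ω) ↔
      ∃ N, SolvableForms.IsSolvable Ω N ∧
        ∃ w : ℝ, ∀ z ∈ SolvableForms.numRange Ω, z.im = 0 ∧ w ≤ z.re) ∧
    -- 4. Kato
    (SolvableForms.IsKatoForm Ω ↔
      ∃ N, SolvableForms.IsSolvableInner Ω N ∧
        ∃ γ θ : ℝ, 0 ≤ θ ∧ θ < Real.pi / 2 ∧
          SolvableForms.numRange Ω ⊆ SolvableForms.sector γ θ ∧
          ∃ l : ℂ, l ∉ SolvableForms.sector γ θ ∧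
            -l • SolvableForms.iota ∈ SolvableForms.perturbations Ω N) ∧
    -- 5. McIntosh, accretive forms
    ((SolvableForms.IsClosedAccretive Ω ↔
      ∃ N, SolvableForms.IsSolvableInner Ω N ∧
        (∀ z ∈ SolvableForms.numRange Ω, 0 ≤ z.re) ∧
        SolvableForms.iota ∈ SolvableForms.perturbations Ω N) ∧
     ((∃ N, SolvableForms.IsSolvableInner Ω N ∧
        (∀ z ∈ SolvableForms.numRange Ω, 0 ≤ z.re) ∧
        -Complex.I • SolvableForms.iota ∈ SolvableForms.perturbations Ω N) →
      SolvableForms.IsClosedAccretive Ω)) ∧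
    -- 6. McIntosh
    (SolvableForms.IsMcIntoshForm Ω ↔
      ∃ N, SolvableForms.IsSolvableInner Ω N ∧
        ∃ l : ℂ, -l • SolvableForms.iota ∈ SolvableForms.perturbations Ω N) ∧
    -- 7. Schmitz: the two implications, and an example where the bounded form cannot be replaced
    -- by a real multiple of the inner product
    ((∀ K : H →L[ℂ] H, SolvableForms.IsSchmitzForm Ω K →
      ∃ N, SolvableForms.IsSolvableInner Ω N ∧
        (∀ z ∈ SolvableForms.numRange Ω, z.im = 0) ∧
        SolvableForms.opForm K ∈ SolvableForms.perturbations Ω N) ∧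
     (∀ J : H →L[ℂ] H, SolvableForms.IsOffDiagonalForm Ω J →
      ∃ N, SolvableForms.IsSolvableInner Ω N ∧
        (∀ z ∈ SolvableForms.numRange Ω, z.im = 0) ∧
        SolvableForms.opForm J ∈ SolvableForms.perturbations Ω N) ∧
     (∃ (E : Submodule ℂ (lp (fun _ : ℕ => ℂ) 2)) (Φ : SolvableForms.SForm E)
        (J : lp (fun _ : ℕ => ℂ) 2 →L[ℂ] lp (fun _ : ℕ => ℂ) 2),
        Dense (E : Set (lp (fun _ : ℕ => ℂ) 2)) ∧
        SolvableForms.IsSchmitzForm Φ J ∧ SolvableForms.IsOffDiagonalForm Φ J ∧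
        (∀ c : ℂ, SolvableForms.opForm J ≠ c • SolvableForms.iota) ∧
        ∀ N, SolvableForms.IsSolvableInner Φ N →
          ∀ l : ℝ, -(l : ℂ) • SolvableForms.iota ∉ SolvableForms.perturbations Φ N)) ∧
    -- 8. Lions, Schmüdgen
    (SolvableForms.IsLionsForm Ω →
      ∃ N, SolvableForms.IsSolvableInner Ω N ∧
        (∃ (u : ℂ) (c : ℝ), ‖u‖ = 1 ∧ 0 < c ∧
          ∀ z ∈ SolvableForms.numRange Ω, c ≤ (u * z).re) ∧
        0 ∈ SolvableForms.perturbations Ω N) := by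
  refine ⟨SolvableForms.isFHSForm_iff, SolvableForms.isGKMVForm_iff hD,
    SolvableForms.isSymmetric_and_isKatoForm_iff, SolvableForms.isKatoForm_iff,
    ⟨SolvableForms.isClosedAccretive_iff, ?_⟩, ?_,
    ⟨fun _ h => h.exists_isSolvableInner, fun _ h => h.exists_isSolvableInner, ?_⟩,
    fun h => h.exists_isSolvableInner⟩
  · rintro ⟨N, hN, hre, h⟩
    exact SolvableForms.isClosedAccretive_iff.2 ⟨N, hN, hre,
      SolvableForms.iota_mem_perturbations_of_accretive hN
        (SolvableForms.re_nonneg_iff_numRange.2 hre) h⟩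
  · constructor
    · rintro ⟨l, hl⟩
      obtain ⟨N, hN, h⟩ := SolvableForms.isZeroClosed_add_restrict_iff.1 hl
      exact ⟨N, hN, l, h⟩
    · rintro ⟨N, hN, l, h⟩
      exact ⟨l, SolvableForms.isZeroClosed_add_restrict_iff.2 ⟨N, hN, h⟩⟩
  · exact ⟨_, SolvableForms.diagForm, SolvableForms.signCLM, SolvableForms.dense_diag_domain _,
      SolvableForms.isSchmitzForm_diagForm, SolvableForms.isOffDiagonalForm_diagForm,
      SolvableForms.opForm_signCLM_ne,
      fun _ hN => SolvableForms.smul_iota_notMem_perturbations_diagForm hN⟩
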